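/- Let $\gamma$ be a rectifiable closed curve in hyperbolic 3-space $\mathbb{H}^3$ (of positive length, parametrized by arc length; it is homotopically trivial, since $\mathbb{H}^3$ is contractible), and suppose that $\gamma$ lies in the boundary of a geodesically convex set $K \subseteq \mathbb{H}^3$. Let $\theta(\gamma)$ be the total geodesic curvature of $\gamma$: if $\gamma$ is of class $C^2$ as a closed curve, then $\theta(\gamma) = \int_\gamma k\,ds$, where $k = |\nabla_{\gamma'}\gamma'|$; for an arbitrary rectifiable closed curve, $\theta(\gamma) \in [0,\infty]$ is the supremum of the sums of the exterior angles of the closed geodesic polygons inscribed in $\gamma$ (with distinct consecutive vertices). Then for every $\epsilon > 0$ the curve $\gamma$ bounds a disk $D$ with $$\operatorname{area}(D) < \theta(\gamma) - 2\pi + \epsilon .$$ For a curve of class $C^2$ the bound holds with either expression for $\theta(\gamma)$. Here a disk bounded by $\gamma$ is a continuous map of the closed unit disk into $\mathbb{H}^3$ whose restriction to the unit circle is $\gamma$, parametrized proportionally to arc length; it is an embedding if $\gamma$ is a simple closed curve. Its area is the two-dimensional Hausdorff measure of its image, counted with multiplicity. -/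

import Mathlib

open MeasureTheory
open scoped ENNReal

/-- The coordinate space `ℝ × ℝ³` of Minkowski space. -/
abbrev Minkowski : Type := ℝ × EuclideanSpace ℝ (Fin 3)

/-- The Lorentzian bilinear form `⟨x, y⟩ - t u` of the vectors `(t, x)` and `(u, y)`. -/
noncomputable def lorentz (v w : Minkowski) : ℝ := inner ℝ v.2 w.2 - v.1 * w.1

/-- Hyperbolic 3-space, as the upper sheet of the hyperboloid in Minkowski space. -/
@[ext]
structure Hyp3 : Type where
  /-- the position vector in Minkowski space -/
  pos : Minkowski
  lorentz_self : lorentz pos pos = -1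
  time_pos : 0 < pos.1

/-- The orthogonal projection of a vector to the tangent space of the hyperboloid at `p`. -/
noncomputable def tangentProj (p : Hyp3) (v : Minkowski) : Minkowski :=
  v + lorentz p.pos v • p.pos

theorem lorentz_comm (v w : Minkowski) : lorentz v w = lorentz w v := by
  simp only [lorentz, real_inner_comm, mul_comm]

theorem lorentz_add_left (u v w : Minkowski) : lorentz (u + v) w = lorentz u w + lorentz v w := by
  simp only [lorentz, Prod.fst_add, Prod.snd_add, inner_add_left]; ring

theorem lorentz_smul_left (a : ℝ) (v w : Minkowski) : lorentz (a • v) w = a * lorentz v w := by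
  simp only [lorentz, Prod.smul_fst, Prod.smul_snd, real_inner_smul_left, smul_eq_mul]; ring

theorem lorentz_add_right (u v w : Minkowski) : lorentz w (u + v) = lorentz w u + lorentz w v := by
  rw [lorentz_comm, lorentz_add_left, lorentz_comm u, lorentz_comm v]

theorem lorentz_smul_right (a : ℝ) (v w : Minkowski) : lorentz w (a • v) = a * lorentz w v := by
  rw [lorentz_comm, lorentz_smul_left, lorentz_comm]

theorem lorentz_tangentProj (p : Hyp3) (v : Minkowski) : lorentz p.pos (tangentProj p v) = 0 := by
  rw [tangentProj, lorentz_add_right, lorentz_smul_right, p.lorentz_self]; ring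

theorem time_sq_mul_le (p : Hyp3) (w : Minkowski) (h : lorentz p.pos w = 0) :
    w.1 ^ 2 * p.pos.1 ^ 2 ≤ ‖w.2‖ ^ 2 * (p.pos.1 ^ 2 - 1) := by
  have h1 := p.lorentz_self
  simp only [lorentz, real_inner_self_eq_norm_sq] at h1 h
  have h2 := real_inner_mul_inner_self_le p.pos.2 w.2
  simp only [real_inner_self_eq_norm_sq] at h2
  have h3 : inner ℝ p.pos.2 w.2 = p.pos.1 * w.1 := by linarith
  have h4 : ‖p.pos.2‖ ^ 2 = p.pos.1 ^ 2 - 1 := by nlinarith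
  rw [h3, h4] at h2
  nlinarith

theorem lorentz_self_nonneg (p : Hyp3) (w : Minkowski) (h : lorentz p.pos w = 0) :
    0 ≤ lorentz w w := by
  have h1 := time_sq_mul_le p w h
  have h2 : 0 < p.pos.1 ^ 2 := pow_pos p.time_pos 2
  simp only [lorentz, real_inner_self_eq_norm_sq]
  have h3 : w.1 ^ 2 * p.pos.1 ^ 2 ≤ ‖w.2‖ ^ 2 * p.pos.1 ^ 2 := by nlinarith [sq_nonneg ‖w.2‖]
  nlinarith [le_of_mul_le_mul_right h3 h2]

theorem eq_zero_of_lorentz_self (p : Hyp3) (w : Minkowski) (h : lorentz p.pos w = 0)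
    (h0 : lorentz w w = 0) : w = 0 := by
  have h1 := time_sq_mul_le p w h
  simp only [lorentz, real_inner_self_eq_norm_sq] at h0
  have h2 : w.1 ^ 2 = 0 := by nlinarith [sq_nonneg w.1]
  have h3 : w.1 = 0 := by simpa using h2
  have h4 : ‖w.2‖ ^ 2 = 0 := by nlinarith
  have h5 : w.2 = 0 := by simpa using h4
  exact Prod.ext h3 h5

theorem lorentz_cauchy_schwarz (p : Hyp3) (u v : Minkowski) (hu : lorentz p.pos u = 0)
    (hv : lorentz p.pos v = 0) : lorentz u v ^ 2 ≤ lorentz u u * lorentz v v := by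
  have key : ∀ x : ℝ, 0 ≤ lorentz v v * (x * x) + (2 * lorentz u v) * x + lorentz u u := by
    intro x
    have h : lorentz p.pos (u + x • v) = 0 := by
      rw [lorentz_add_right, lorentz_smul_right, hu, hv]; ring
    have h1 := lorentz_self_nonneg p _ h
    simp only [lorentz_add_right, lorentz_smul_right, lorentz_add_left, lorentz_smul_left,
      lorentz_comm v u] at h1
    linarith
  have h := discrim_le_zero key
  simp only [discrim] at h
  nlinarith

theorem lorentz_tangentProj_tangentProj (p : Hyp3) (v w : Minkowski) :
    lorentz (tangentProj p v) (tangentProj p w)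
      = lorentz v w + lorentz p.pos v * lorentz p.pos w := by
  simp only [tangentProj, lorentz_add_right, lorentz_smul_right, lorentz_add_left,
    lorentz_smul_left, p.lorentz_self, lorentz_comm v p.pos]
  ring

theorem one_le_neg_lorentz (p q : Hyp3) : 1 ≤ -lorentz p.pos q.pos := by
  have h1 := lorentz_self_nonneg p _ (lorentz_tangentProj p q.pos)
  rw [lorentz_tangentProj_tangentProj, q.lorentz_self] at h1
  have hp := p.lorentz_self
  have hq := q.lorentz_self
  have h2 := real_inner_le_norm p.pos.2 q.pos.2
  simp only [lorentz, real_inner_self_eq_norm_sq] at hp hq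
  have h3 : ‖p.pos.2‖ ≤ p.pos.1 := by nlinarith [norm_nonneg p.pos.2, p.time_pos]
  have h4 : ‖q.pos.2‖ ≤ q.pos.1 := by nlinarith [norm_nonneg q.pos.2, q.time_pos]
  have h5 : 0 ≤ -lorentz p.pos q.pos := by
    simp only [lorentz]
    nlinarith [mul_le_mul h3 h4 (norm_nonneg _) p.time_pos.le]
  nlinarith

theorem neg_lorentz_le (a b c : Hyp3) :
    -lorentz a.pos c.pos ≤ Real.cosh
      (Real.arcosh (-lorentz a.pos b.pos) + Real.arcosh (-lorentz b.pos c.pos)) := by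
  have hα := one_le_neg_lorentz a b
  have hβ := one_le_neg_lorentz b c
  rw [Real.cosh_add, Real.cosh_arcosh hα, Real.cosh_arcosh hβ, Real.sinh_arcosh hα,
    Real.sinh_arcosh hβ]
  have h := lorentz_cauchy_schwarz b _ _ (lorentz_tangentProj b a.pos) (lorentz_tangentProj b c.pos)
  simp only [lorentz_tangentProj_tangentProj, a.lorentz_self, c.lorentz_self] at h
  rw [lorentz_comm b.pos a.pos] at h
  rw [← Real.sqrt_mul (by nlinarith)]
  have h2 := Real.abs_le_sqrt h
  have h3 : ((-1 + lorentz a.pos b.pos * lorentz a.pos b.pos)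
      * (-1 + lorentz b.pos c.pos * lorentz b.pos c.pos))
      = ((-lorentz a.pos b.pos) ^ 2 - 1) * ((-lorentz b.pos c.pos) ^ 2 - 1) := by ring
  rw [h3] at h2
  linarith [neg_le_of_abs_le h2]

/-- The hyperbolic distance `d(p, q) = arcosh (-⟨p, q⟩)`. -/
noncomputable instance : MetricSpace Hyp3 where
  dist p q := Real.arcosh (-lorentz p.pos q.pos)
  dist_self p := by simp [p.lorentz_self]
  dist_comm p q := by rw [lorentz_comm]
  dist_triangle a b c := by
    have h1 := one_le_neg_lorentz a c
    have h2 := Real.arcosh_nonneg (one_le_neg_lorentz a b)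
    have h3 := Real.arcosh_nonneg (one_le_neg_lorentz b c)
    rw [← Real.arcosh_cosh (add_nonneg h2 h3),
      Real.arcosh_le_arcosh (by linarith) (Real.cosh_pos _)]
    exact neg_lorentz_le a b c
  eq_of_dist_eq_zero {a b} h := by
    have h1 := (Real.arcosh_eq_zero_iff (one_le_neg_lorentz a b)).1 h
    have h2 : lorentz a.pos b.pos = -1 := by linarith
    have h3 := eq_zero_of_lorentz_self a _ (lorentz_tangentProj a b.pos) (by
      rw [lorentz_tangentProj_tangentProj, b.lorentz_self, h2]; ring)
    rw [tangentProj, h2] at h3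
    ext1
    exact (eq_of_sub_eq_zero (by rw [← h3]; module)).symm

noncomputable instance : MeasurableSpace Hyp3 := borel Hyp3

instance : BorelSpace Hyp3 := ⟨rfl⟩

/-- `K` is geodesically convex: it contains the geodesic segment between any two of its points.
The geodesic segment from `p` to `q` consists of the points of the hyperboloid whose position
vector is a combination of those of `p` and `q` with nonnegative coefficients. -/
def GeodesicallyConvex (K : Set Hyp3) : Prop :=
  ∀ p ∈ K, ∀ q ∈ K, ∀ x : Hyp3, ∀ a b : ℝ, 0 ≤ a → 0 ≤ b →
    x.pos = a • p.pos + b • q.pos → x ∈ K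

/-- The angle at `p` between the geodesic rays from `p` through `q` and through `r`. The vector
`tangentProj p q.pos` is a positive multiple of the initial velocity of the ray through `q ≠ p`. -/
noncomputable def hypAngle (q p r : Hyp3) : ℝ :=
  Real.arccos (lorentz (tangentProj p q.pos) (tangentProj p r.pos) /
    (√(lorentz (tangentProj p q.pos) (tangentProj p q.pos)) *
      √(lorentz (tangentProj p r.pos) (tangentProj p r.pos))))

/-- A rectifiable closed curve of length `L > 0`: its parametrization by arc length, extended to
the whole line with period `L`. -/
structure IsRectifiableClosedCurve (γ : ℝ → Hyp3) (L : ℝ) : Prop where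
  length_pos : 0 < L
  periodic : Function.Periodic γ L
  unitSpeed : HasUnitSpeedOn γ Set.univ

/-- The parameters `… < t i < t (i + 1) < …` (periodic with `n` steps per turn) of the vertices of
a closed geodesic polygon with `n` vertices that is inscribed in the closed curve `γ` of
length `L`; consecutive vertices are distinct points. -/
structure IsInscribedPolygon (γ : ℝ → Hyp3) (L : ℝ) (n : ℕ) (t : ℕ → ℝ) : Prop where
  two_le : 2 ≤ n
  strictMono : StrictMono t
  periodic : ∀ i, t (i + n) = t i + L
  ne : ∀ i, γ (t i) ≠ γ (t (i + 1))

/-- The sum of the exterior angles of the closed geodesic polygon with the `n` successive vertices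
`γ (t 1), …, γ (t n)`. -/
noncomputable def sumExteriorAngles (γ : ℝ → Hyp3) (n : ℕ) (t : ℕ → ℝ) : ℝ :=
  ∑ i ∈ Finset.range n, (Real.pi - hypAngle (γ (t i)) (γ (t (i + 1))) (γ (t (i + 2))))

/-- The total geodesic curvature of a rectifiable closed curve, with no smoothness assumed (it may
be infinite): the supremum of the sums of the exterior angles of the inscribed geodesic polygons. -/
noncomputable def totalCurvature (γ : ℝ → Hyp3) (L : ℝ) : ℝ≥0∞ :=
  ⨆ (n : ℕ) (t : ℕ → ℝ) (_ : IsInscribedPolygon γ L n t),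
    ENNReal.ofReal (sumExteriorAngles γ n t)

/-- The geodesic curvature `|∇_{γ'} γ'|` of a curve parametrized by arc length. The covariant
derivative along `γ` is the tangential part of the derivative in Minkowski space. -/
noncomputable def geodesicCurvature (γ : ℝ → Hyp3) (s : ℝ) : ℝ :=
  let acc : Minkowski := tangentProj (γ s) (deriv (deriv fun u => (γ u).pos) s)
  √(lorentz acc acc)

/-- The area of the disk parametrized by `f` on the closed unit disk of `ℂ`: the two-dimensional
(normalized) Hausdorff measure of the image, counted with multiplicity. For injective `f` this is
the area of the image. -/
noncomputable def diskArea (f : ℂ → Hyp3) : ℝ≥0∞ :=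
  ∫⁻ y, ((({z ∈ Metric.closedBall (0 : ℂ) 1 | f z = y}).encard : ℕ∞) : ℝ≥0∞) ∂μHE[2]

/-- `f` parametrizes a disk bounded by the closed curve `γ` of length `L`; if `γ` is a simple closed
curve, then the disk is embedded. -/
structure IsDiskBoundedBy (f : ℂ → Hyp3) (γ : ℝ → Hyp3) (L : ℝ) : Prop where
  continuousOn : ContinuousOn f (Metric.closedBall 0 1)
  boundary : ∀ s : ℝ, f (Circle.exp (2 * Real.pi * s / L)) = γ s
  embedded : Set.InjOn γ (Set.Ico 0 L) → Set.InjOn f (Metric.closedBall 0 1)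

/-!
The disk is a geodesic cone. Let `p` be a point off the curve, and join it to the points of `γ` by
geodesic segments. Three facts make this work.

*The apex.* If `p` is in the interior of `K`, then every ray from `p` meets the boundary of `K`, and
hence `γ`, in at most one point; if `K` has no interior, then it lies in a totally geodesic plane
and any point off the plane will do. Such a `p` can be found arbitrarily close to the midpoint of a
chord of the curve (`exists_seesOnce`). From there the endpoints of the chord are seen at an angle
of almost `π`, so that each of the two arcs of `γ` between them contributes almost `π` to the length
of the curve of directions from `p` to `γ` on the unit sphere; this length, the cone angle, is more
than `2 π - ε` (`exists_apex`). Since each ray meets the curve in at most one point, the cone is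
embedded if `γ` is simple (`isDiskBoundedBy_coneDisk`).

*The area.* In polar coordinates about `p`, the area of the cone is the integral of `cosh ρ - 1`
with respect to the length of the curve of directions, where `ρ` is the distance from `p`. So the
area plus the cone angle is the integral of `cosh ρ`, and it suffices to bound `cosh ρ` times a
short chord of directions by quantities `X s t` whose sums along chains of parameters are controlled
(`diskArea_le_of_chainSum_le`). The upper bound of the area is enough: the Hausdorff measure of a
thin sector of the cone is compared with that of a rectangle, ring by ring
(`measure_coneShell_le`), and the area with multiplicity is at most the limit of the sums of the
areas of the sectors by Fatou's lemma (`lintegral_encard_fibre_le`).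

*The curvature.* For the angles of inscribed polygons, `X s t` is `π` minus the sum of the two base
angles of the triangle `p, γ s, γ t`. The hyperbolic law of cosines bounds it below by `cosh ρ`
times the chord, up to an error of smaller order (`sin_hypAngle_mul_le_angleComplement`), and the
triangle inequality for angles at a vertex shows that the sum over the edges of a closed polygon is
at most the sum of the exterior angles (`sum_angleComplement_le`). For a curve of class `C²`,
`X s t` is the increment of the integral of the curvature minus the angle `ψ` between the curve and
the radial direction: infinitesimally, `cosh ρ |u'| ≤ k - ψ'` for the direction `u`
(`radial_angle_inequality`). Since `ψ` is periodic, it drops out of the total.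
-/

/-! ### Charts of hyperbolic space -/

/-- The linear map from Minkowski space to `ℝ³` that annihilates `p` and restricts to an isometry
of the orthogonal complement of `p` (the space part of the boost that takes `p` to the vertex of
the hyperboloid). On the hyperboloid it is a chart in which the geodesic rays from `p` are the
straight rays from the origin, and `‖chart p q‖` is the hyperbolic sine of the distance. -/
noncomputable def chart (p : Hyp3) (v : Minkowski) : EuclideanSpace ℝ (Fin 3) :=
  v.2 + ((lorentz p.pos v - v.1) / (1 + p.pos.1)) • p.pos.2

theorem norm_space_sq (p : Hyp3) : ‖p.pos.2‖ ^ 2 = p.pos.1 ^ 2 - 1 := by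
  have := p.lorentz_self
  simp only [lorentz, real_inner_self_eq_norm_sq] at this
  linarith

theorem inner_chart (p : Hyp3) (v w : Minkowski) :
    inner ℝ (chart p v) (chart p w) = lorentz v w + lorentz p.pos v * lorentz p.pos w := by
  have h0 := norm_space_sq p
  have h1 : (1 + p.pos.1) ≠ 0 := by linarith [p.time_pos]
  simp only [chart, inner_add_left, inner_add_right, real_inner_smul_left, real_inner_smul_right,
    real_inner_self_eq_norm_sq, h0]
  have ev : inner ℝ v.2 p.pos.2 = lorentz p.pos v + p.pos.1 * v.1 := by
    rw [real_inner_comm]; simp only [lorentz]; ring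
  have ew : inner ℝ p.pos.2 w.2 = lorentz p.pos w + p.pos.1 * w.1 := by
    simp only [lorentz]; ring
  have evw : inner ℝ v.2 w.2 = lorentz v w + v.1 * w.1 := by
    simp only [lorentz]; ring
  rw [ev, ew, evw]
  field_simp
  ring

theorem chart_add (p : Hyp3) (v w : Minkowski) : chart p (v + w) = chart p v + chart p w := by
  simp only [chart, lorentz_add_right, Prod.fst_add, Prod.snd_add]
  module

theorem chart_smul (p : Hyp3) (a : ℝ) (v : Minkowski) : chart p (a • v) = a • chart p v := by
  simp only [chart, lorentz_smul_right, Prod.smul_fst, Prod.smul_snd, smul_eq_mul]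
  module

theorem norm_chart_sq (p q : Hyp3) : ‖chart p q.pos‖ ^ 2 = lorentz p.pos q.pos ^ 2 - 1 := by
  rw [← real_inner_self_eq_norm_sq, inner_chart, q.lorentz_self]
  ring

/-- The vector of Minkowski space with the given coordinate in the chart at `p`, on the upper sheet
of the hyperboloid. -/
noncomputable def ofChartPos (p : Hyp3) (y : EuclideanSpace ℝ (Fin 3)) : Minkowski :=
  √(1 + ‖y‖ ^ 2) • p.pos +
    ((inner ℝ p.pos.2 y, y + (inner ℝ p.pos.2 y / (1 + p.pos.1)) • p.pos.2) : Minkowski)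

theorem lorentz_boost (p : Hyp3) (y : EuclideanSpace ℝ (Fin 3)) :
    lorentz p.pos
      ((inner ℝ p.pos.2 y, y + (inner ℝ p.pos.2 y / (1 + p.pos.1)) • p.pos.2) : Minkowski) = 0 := by
  have h0 := norm_space_sq p
  have h1 : (1 + p.pos.1) ≠ 0 := by linarith [p.time_pos]
  simp only [lorentz, inner_add_right, real_inner_smul_right, real_inner_self_eq_norm_sq, h0]
  field_simp
  ring

theorem lorentz_ofChartPos (p : Hyp3) (y : EuclideanSpace ℝ (Fin 3)) :
    lorentz p.pos (ofChartPos p y) = -√(1 + ‖y‖ ^ 2) := by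
  rw [ofChartPos, lorentz_add_right, lorentz_smul_right, lorentz_boost, p.lorentz_self]
  ring

theorem chart_ofChartPos (p : Hyp3) (y : EuclideanSpace ℝ (Fin 3)) :
    chart p (ofChartPos p y) = y := by
  have h1 : (1 + p.pos.1) ≠ 0 := by linarith [p.time_pos]
  rw [chart, lorentz_ofChartPos]
  simp only [ofChartPos, Prod.fst_add, Prod.snd_add, Prod.smul_fst, Prod.smul_snd, smul_eq_mul]
  generalize √(1 + ‖y‖ ^ 2) = a
  have : a • p.pos.2 + (y + (inner ℝ p.pos.2 y / (1 + p.pos.1)) • p.pos.2) +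
      ((-a - (a * p.pos.1 + inner ℝ p.pos.2 y)) / (1 + p.pos.1)) • p.pos.2 =
      y + (a + inner ℝ p.pos.2 y / (1 + p.pos.1) +
      (-a - (a * p.pos.1 + inner ℝ p.pos.2 y)) / (1 + p.pos.1)) • p.pos.2 := by module
  rw [this, show (a + inner ℝ p.pos.2 y / (1 + p.pos.1) +
      (-a - (a * p.pos.1 + inner ℝ p.pos.2 y)) / (1 + p.pos.1)) = 0 by field_simp; ring]
  simp

/-- The inverse of the chart at `p`. -/
noncomputable def ofChart (p : Hyp3) (y : EuclideanSpace ℝ (Fin 3)) : Hyp3 where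
  pos := ofChartPos p y
  lorentz_self := by
    have h := inner_chart p (ofChartPos p y) (ofChartPos p y)
    rw [chart_ofChartPos, lorentz_ofChartPos, real_inner_self_eq_norm_sq] at h
    have := Real.sq_sqrt (show 0 ≤ 1 + ‖y‖ ^ 2 by positivity)
    nlinarith
  time_pos := by
    have h := abs_le.1 (abs_real_inner_le_norm p.pos.2 y)
    have h0 := norm_space_sq p
    have hp := p.time_pos
    have h2 : ‖p.pos.2‖ ≤ p.pos.1 := by
      nlinarith [norm_nonneg p.pos.2]
    have h3 : ‖y‖ < √(1 + ‖y‖ ^ 2) := by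
      apply Real.lt_sqrt_of_sq_lt; linarith
    simp only [ofChartPos, Prod.fst_add, Prod.smul_fst, smul_eq_mul]
    nlinarith [mul_le_mul_of_nonneg_right h2 (norm_nonneg y), mul_lt_mul_of_pos_left h3 hp]

theorem ofChart_pos (p : Hyp3) (y : EuclideanSpace ℝ (Fin 3)) :
    (ofChart p y).pos = ofChartPos p y := rfl

theorem chart_ofChart (p : Hyp3) (y : EuclideanSpace ℝ (Fin 3)) :
    chart p (ofChart p y).pos = y := chart_ofChartPos p y

theorem ofChart_injective (p : Hyp3) : Function.Injective (ofChart p) := fun y z h => by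
  rw [← chart_ofChart p y, h, chart_ofChart]

/-- The law of cosines in the chart at `p`. -/
theorem neg_lorentz_eq (p q q' : Hyp3) : -lorentz q.pos q'.pos =
    lorentz p.pos q.pos * lorentz p.pos q'.pos - inner ℝ (chart p q.pos) (chart p q'.pos) := by
  rw [inner_chart]; ring

theorem sqrt_one_add_norm_chart_sq (p q : Hyp3) :
    √(1 + ‖chart p q.pos‖ ^ 2) = -lorentz p.pos q.pos := by
  rw [norm_chart_sq, show 1 + (lorentz p.pos q.pos ^ 2 - 1) = (-lorentz p.pos q.pos) ^ 2 by ring,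
    Real.sqrt_sq (by linarith [one_le_neg_lorentz p q])]

theorem eq_of_neg_lorentz_le_one (p q : Hyp3) (h : -lorentz p.pos q.pos ≤ 1) : p = q := by
  have h1 : -lorentz p.pos q.pos = 1 := le_antisymm h (one_le_neg_lorentz p q)
  apply eq_of_dist_eq_zero
  change Real.arcosh (-lorentz p.pos q.pos) = 0
  rw [h1, (Real.arcosh_eq_zero_iff le_rfl).2 rfl]

theorem chart_injective (p q q' : Hyp3) (h : chart p q.pos = chart p q'.pos) : q = q' := by
  apply eq_of_neg_lorentz_le_one
  rw [neg_lorentz_eq p, h, real_inner_self_eq_norm_sq, norm_chart_sq]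
  have h1 := sqrt_one_add_norm_chart_sq p q
  rw [h, sqrt_one_add_norm_chart_sq p q'] at h1
  have h2 : lorentz p.pos q.pos = lorentz p.pos q'.pos := by linarith
  rw [h2]; linarith

theorem ofChart_chart (p q : Hyp3) : ofChart p (chart p q.pos) = q :=
  chart_injective p _ _ (chart_ofChart p _)

theorem lorentz_ofChart_ofChart (p : Hyp3) (y z : EuclideanSpace ℝ (Fin 3)) :
    -lorentz (ofChart p y).pos (ofChart p z).pos =
      √(1 + ‖y‖ ^ 2) * √(1 + ‖z‖ ^ 2) - inner ℝ y z := by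
  rw [neg_lorentz_eq p, chart_ofChart, chart_ofChart, ofChart_pos, ofChart_pos,
    lorentz_ofChartPos, lorentz_ofChartPos]
  ring

theorem hyp3_dist_eq (p q : Hyp3) : dist p q = Real.arcosh (-lorentz p.pos q.pos) := rfl

theorem cosh_dist (p q : Hyp3) : Real.cosh (dist p q) = -lorentz p.pos q.pos := by
  rw [hyp3_dist_eq, Real.cosh_arcosh (one_le_neg_lorentz p q)]

theorem norm_chart_eq_sinh (p q : Hyp3) : ‖chart p q.pos‖ = Real.sinh (dist p q) := by
  rw [← sq_eq_sq₀ (norm_nonneg _) (Real.sinh_nonneg_iff.2 dist_nonneg), norm_chart_sq,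
    Real.sinh_sq, cosh_dist]
  ring

theorem ofChartPos_smul (p : Hyp3) (y : EuclideanSpace ℝ (Fin 3)) (b : ℝ) : ofChartPos p (b • y) =
    (√(1 + ‖b • y‖ ^ 2) - b * √(1 + ‖y‖ ^ 2)) • p.pos + b • ofChartPos p y := by
  simp only [ofChartPos]
  ext1
  · simp only [Prod.fst_add, Prod.smul_fst, smul_eq_mul, inner_smul_right]; ring
  · simp only [Prod.snd_add, Prod.smul_snd, inner_smul_right]
    module

/-- The points of the straight ray through `q` in the chart at `p` are linear combinations of `p`
and `q`, that is, they are on a geodesic line through `p` and `q`. -/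
theorem ofChart_smul_chart (p q : Hyp3) (b : ℝ) : (ofChart p (b • chart p q.pos)).pos =
    (√(1 + ‖b • chart p q.pos‖ ^ 2) + b * lorentz p.pos q.pos) • p.pos + b • q.pos := by
  rw [ofChart_pos, ofChartPos_smul, sqrt_one_add_norm_chart_sq, ← ofChart_pos, ofChart_chart,
    mul_neg, sub_neg_eq_add]

/-- The coefficient of `p` in `ofChart_smul_chart` is positive between `p` and `q`. -/
theorem apex_coeff_pos (p q : Hyp3) (b : ℝ) (hb0 : 0 ≤ b) (hb : b < 1) :
    0 < √(1 + ‖b • chart p q.pos‖ ^ 2) + b * lorentz p.pos q.pos := by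
  rw [norm_smul, mul_pow, norm_chart_sq, Real.norm_eq_abs, sq_abs]
  have h1 := one_le_neg_lorentz p q
  have : b * -lorentz p.pos q.pos < √(1 + b ^ 2 * (lorentz p.pos q.pos ^ 2 - 1)) := by
    apply Real.lt_sqrt_of_sq_lt
    nlinarith
  linarith

/-! ### Topology of hyperbolic space -/

theorem continuous_lorentz : Continuous fun v : Minkowski × Minkowski => lorentz v.1 v.2 := by
  unfold lorentz; fun_prop

theorem Continuous.lorentz {X : Type*} [TopologicalSpace X] {f g : X → Minkowski}
    (hf : Continuous f) (hg : Continuous g) : Continuous fun x => lorentz (f x) (g x) :=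
  continuous_lorentz.comp (hf.prodMk hg)

theorem ContinuousAt.lorentz {X : Type*} [TopologicalSpace X] {f g : X → Minkowski} {x : X}
    (hf : ContinuousAt f x) (hg : ContinuousAt g x) :
    ContinuousAt (fun x => lorentz (f x) (g x)) x := by
  unfold _root_.lorentz
  fun_prop

theorem continuous_chart (p : Hyp3) : Continuous (chart p) := by
  unfold chart
  have : Continuous fun v => lorentz p.pos v := continuous_const.lorentz continuous_id
  fun_prop

/-- The topology of Minkowski space is at least as fine as that of the hyperbolic metric. -/
theorem continuousAt_hyp3 {X : Type*} [TopologicalSpace X] {f : X → Hyp3} {x : X}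
    (hf : ContinuousAt (fun x => (f x).pos) x) : ContinuousAt f x := by
  unfold ContinuousAt
  rw [tendsto_iff_dist_tendsto_zero]
  have h1 : ContinuousAt (fun z => -lorentz (f z).pos (f x).pos) x :=
    (hf.lorentz continuousAt_const).neg
  have h2 : ContinuousOn Real.arcosh (Set.Ici 1) := Real.continuousOn_arcosh
  have h3 : ContinuousWithinAt Real.arcosh (Set.Ici 1) (-lorentz (f x).pos (f x).pos) :=
    h2 _ (by simp [(f x).lorentz_self])
  have h4 := h3.tendsto.comp (tendsto_nhdsWithin_iff.2 ⟨h1.tendsto,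
    Filter.Eventually.of_forall fun z => one_le_neg_lorentz (f z) (f x)⟩)
  simpa [hyp3_dist_eq, Function.comp_def, (f x).lorentz_self] using h4

theorem continuous_ofChart (p : Hyp3) : Continuous (ofChart p) := by
  rw [continuous_iff_continuousAt]
  intro y
  apply continuousAt_hyp3
  simp only [ofChart_pos, ofChartPos]
  fun_prop

/-- The topology of the hyperbolic metric is at least as fine as that of Minkowski space. -/
theorem continuous_pos : Continuous Hyp3.pos := by
  rw [continuous_iff_continuousAt]
  intro p
  have h0 : Continuous fun q : Hyp3 => ‖chart p q.pos‖ := by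
    simp only [norm_chart_eq_sinh]
    exact Real.continuous_sinh.comp (continuous_const.dist continuous_id)
  have h1 : ContinuousAt (fun q : Hyp3 => chart p q.pos) p := by
    unfold ContinuousAt
    have h2 : chart p p.pos = 0 := by
      rw [← norm_eq_zero, norm_chart_eq_sinh]; simp
    simp only [h2]
    rw [tendsto_zero_iff_norm_tendsto_zero]
    simpa [h2] using h0.tendsto p
  have h3 : Hyp3.pos = fun q => ofChartPos p (chart p q.pos) := by
    funext q
    rw [← ofChart_pos, ofChart_chart]
  rw [h3]
  have h4 : Continuous (ofChartPos p) := by unfold ofChartPos; fun_prop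
  exact ContinuousAt.comp (f := fun q : Hyp3 => chart p q.pos) h4.continuousAt h1

/-! ### The area of a thin cone -/

theorem cosh_eq_one_add_two_mul_sinh_sq (x : ℝ) :
    Real.cosh x = 1 + 2 * Real.sinh (|x| / 2) ^ 2 := by
  have h2 := Real.cosh_two_mul (|x| / 2)
  rw [mul_div_cancel₀ _ (two_ne_zero), Real.cosh_abs, Real.cosh_sq] at h2
  linarith

theorem sq_le_two_mul_cosh_sub_one (x : ℝ) : x ^ 2 ≤ 2 * (Real.cosh x - 1) := by
  have h : |x| / 2 ≤ Real.sinh (|x| / 2) := Real.self_le_sinh_iff.2 (by positivity)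
  have h1 := pow_le_pow_left₀ (by positivity) h 2
  rw [div_pow, sq_abs] at h1
  rw [cosh_eq_one_add_two_mul_sinh_sq]
  linarith

theorem two_mul_cosh_sub_one_le (x h : ℝ) (hx : |x| ≤ h) :
    2 * (Real.cosh x - 1) ≤ Real.cosh h ^ 2 * x ^ 2 := by
  have key : ∀ y : ℝ, 0 ≤ y → Real.sinh y ≤ y * Real.cosh y := by
    intro y hy
    have hd : ∀ z : ℝ, HasDerivAt (fun z => z * Real.cosh z - Real.sinh z)
        (z * Real.sinh z) z := by
      intro z
      refine (((hasDerivAt_id z).mul (Real.hasDerivAt_cosh z)).sub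
        (Real.hasDerivAt_sinh z)).congr_deriv ?_
      rw [one_mul, id, add_sub_cancel_left]
    have hm : MonotoneOn (fun z => z * Real.cosh z - Real.sinh z) (Set.Ici 0) := by
      apply monotoneOn_of_deriv_nonneg (convex_Ici 0)
      · fun_prop
      · exact fun z _ => (hd z).differentiableAt.differentiableWithinAt
      · intro z hz
        rw [(hd z).deriv]
        rw [interior_Ici] at hz
        exact mul_nonneg (le_of_lt hz) (Real.sinh_nonneg_iff.2 (le_of_lt hz))
    have := hm (Set.self_mem_Ici) hy hy
    simp at this
    linarith
  have h1 := cosh_eq_one_add_two_mul_sinh_sq x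
  have h3 := key (|x| / 2) (by positivity)
  have h4 : Real.cosh (|x| / 2) ≤ Real.cosh h := by
    rw [Real.cosh_le_cosh, abs_of_nonneg (by positivity), abs_of_nonneg ((abs_nonneg x).trans hx)]
    linarith [abs_nonneg x]
  have h5 : Real.sinh (|x| / 2) ≤ |x| / 2 * Real.cosh h :=
    h3.trans (mul_le_mul_of_nonneg_left h4 (by positivity))
  have h6 : Real.sinh (|x| / 2) ^ 2 ≤ (|x| / 2 * Real.cosh h) ^ 2 :=
    pow_le_pow_left₀ (Real.sinh_nonneg_iff.2 (by positivity)) h5 2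
  rw [mul_pow, div_pow, sq_abs] at h6
  rw [h1]
  linarith

theorem cosh_dist_ofChart (p : Hyp3) (r r' : ℝ) {u u' : EuclideanSpace ℝ (Fin 3)}
    (hu : ‖u‖ = 1) (hu' : ‖u'‖ = 1) :
    Real.cosh (dist (ofChart p (Real.sinh r • u)) (ofChart p (Real.sinh r' • u'))) =
      Real.cosh (r - r') + Real.sinh r * Real.sinh r' * (‖u - u'‖ ^ 2 / 2) := by
  have hs : ∀ (r : ℝ) (u : EuclideanSpace ℝ (Fin 3)), ‖u‖ = 1 →
      √(1 + ‖Real.sinh r • u‖ ^ 2) = Real.cosh r := by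
    intro r u hu
    rw [norm_smul, hu, mul_one, Real.norm_eq_abs, sq_abs, add_comm, ← Real.cosh_sq,
      Real.sqrt_sq (Real.cosh_pos r).le]
  rw [cosh_dist, lorentz_ofChart_ofChart, hs r u hu, hs r' u' hu', real_inner_smul_left,
    real_inner_smul_right, @norm_sub_sq_real, hu, hu', Real.cosh_sub]
  ring

/-- Polar coordinates with a radial coordinate at most `R` and steps at most `h` stretch the
distance of the cylinder of radius `sinh R` by a factor of at most `cosh h`. -/
theorem dist_ofChart_sq_le (p : Hyp3) {r r' h R : ℝ} {u u' : EuclideanSpace ℝ (Fin 3)}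
    (hu : ‖u‖ = 1) (hu' : ‖u'‖ = 1) (hr : |r - r'| ≤ h) (h0 : 0 ≤ r) (h0' : 0 ≤ r') (hR : r ≤ R)
    (hR' : r' ≤ R) :
    dist (ofChart p (Real.sinh r • u)) (ofChart p (Real.sinh r' • u')) ^ 2 ≤
      Real.cosh h ^ 2 * ((r - r') ^ 2 + (Real.sinh R * ‖u - u'‖) ^ 2) := by
  have h1 := sq_le_two_mul_cosh_sub_one
    (dist (ofChart p (Real.sinh r • u)) (ofChart p (Real.sinh r' • u')))
  rw [cosh_dist_ofChart p r r' hu hu'] at h1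
  have h2 := two_mul_cosh_sub_one_le _ _ hr
  have h3 : Real.sinh r * Real.sinh r' ≤ Real.sinh R * Real.sinh R :=
    mul_le_mul (Real.sinh_le_sinh.2 hR) (Real.sinh_le_sinh.2 hR') (Real.sinh_nonneg_iff.2 h0')
      (Real.sinh_nonneg_iff.2 (h0.trans hR))
  have h4 : 1 ≤ Real.cosh h ^ 2 := one_le_pow₀ (Real.one_le_cosh h)
  have h5 := mul_le_mul_of_nonneg_right h3 (sq_nonneg ‖u - u'‖)
  have h6 := mul_le_mul_of_nonneg_right h4 (sq_nonneg (Real.sinh R * ‖u - u'‖))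
  nlinarith

/-- If `f` changes distances by at most `K` times as much as `g`, then the image of `f` has at most
`K ^ 2` times the area of the image of `g`: it is a Lipschitz image of it. -/
theorem euclideanHausdorffMeasure_image_le {ι X Y : Type*} [MetricSpace X] [MeasurableSpace X]
    [BorelSpace X] [MetricSpace Y] [MeasurableSpace Y] [BorelSpace Y] {f : ι → X} {g : ι → Y}
    {s : Set ι} (K : NNReal) (h : ∀ x ∈ s, ∀ y ∈ s, dist (f x) (f y) ≤ K * dist (g x) (g y)) :
    μHE[2] (f '' s) ≤ (K : ℝ≥0∞) ^ 2 * μHE[2] (g '' s) := by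
  classical
  rcases s.eq_empty_or_nonempty with rfl | ⟨x0, hx0⟩
  · simp
  have hinv : ∀ z : Y, ∃ x ∈ s, z ∈ g '' s → g x = z := by
    intro z
    by_cases hz : z ∈ g '' s
    · obtain ⟨x, hx, rfl⟩ := hz
      exact ⟨x, hx, fun _ => rfl⟩
    · exact ⟨x0, hx0, fun h => absurd h hz⟩
  choose c hc hgc using hinv
  have hfac : f '' s = (fun z => f (c z)) '' (g '' s) := by
    rw [Set.image_image]
    refine Set.image_congr fun x hx => ?_
    have h1 := h x hx (c (g x)) (hc _)
    rw [hgc _ (Set.mem_image_of_mem g hx), dist_self, mul_zero] at h1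
    exact dist_le_zero.1 h1
  have hL : LipschitzOnWith K (fun z => f (c z)) (g '' s) := by
    refine LipschitzOnWith.of_dist_le_mul fun z hz w hw => ?_
    have h1 := h (c z) (hc z) (c w) (hc w)
    rwa [hgc z hz, hgc w hw] at h1
  rw [hfac, Measure.euclideanHausdorffMeasure_def, Measure.euclideanHausdorffMeasure_def]
  have h2 := hL.hausdorffMeasure_image_le (d := 2) (by norm_num)
  simp only [Measure.smul_apply, ENNReal.smul_def, smul_eq_mul]
  rw [mul_left_comm]
  gcongr
  simpa using h2

theorem volume_box (a b c d : ℝ) :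
    volume {x : EuclideanSpace ℝ (Fin 2) | x 0 ∈ Set.Icc a b ∧ x 1 ∈ Set.Icc c d} =
      ENNReal.ofReal (b - a) * ENNReal.ofReal (d - c) := by
  have h := EuclideanSpace.volume_preserving_symm_measurableEquiv_toLp (Fin 2)
  have h2 := h.measure_preimage_equiv (Set.pi Set.univ (![Set.Icc a b, Set.Icc c d]))
  rw [volume_pi_pi] at h2
  simp only [Fin.prod_univ_two, Matrix.cons_val_zero, Matrix.cons_val_one, Real.volume_Icc] at h2
  rw [← h2]
  congr 1
  ext x
  simp [Set.mem_pi, Fin.forall_fin_two]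

/-- The part of the geodesic cone from `p` over the directions `u s` with `s ∈ [a, b]` that lies
between the spheres of radius `r₀` and `r₁`. -/
def coneShell (p : Hyp3) (u : ℝ → EuclideanSpace ℝ (Fin 3)) (r₀ r₁ a b : ℝ) : Set Hyp3 :=
  (fun x : ℝ × ℝ => ofChart p (Real.sinh x.1 • u x.2)) '' (Set.Icc r₀ r₁ ×ˢ Set.Icc a b)

/-- A thin shell of a thin cone is a stretched image of a plane set in a rectangle, whose sides are
the thickness of the shell and its outer width. The function `A` dominates the chords of `u`, such
as its arc length. -/
theorem measure_coneShell_le_rectangle (p : Hyp3) {u : ℝ → EuclideanSpace ℝ (Fin 3)} {A : ℝ → ℝ}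
    {a b r₀ r₁ : ℝ} (hr₀ : 0 ≤ r₀) (hr : r₀ ≤ r₁) (hu : ∀ s, ‖u s‖ = 1)
    (hA : ∀ s t, s ≤ t → ‖u s - u t‖ ≤ A t - A s) :
    μHE[2] (coneShell p u r₀ r₁ a b) ≤
      ENNReal.ofReal (Real.cosh (r₁ - r₀) ^ 2 * ((r₁ - r₀) * Real.sinh r₁) * (A b - A a)) := by
  have hmono : Monotone A := fun s t hst => by linarith [hA s t hst, norm_nonneg (u s - u t)]
  have hs1 : 0 ≤ Real.sinh r₁ := Real.sinh_nonneg_iff.2 (hr₀.trans hr)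
  have hA' : ∀ s t, ‖u s - u t‖ ^ 2 ≤ (A s - A t) ^ 2 := by
    intro s t
    rcases le_total s t with h | h
    · rw [← neg_sub (A t), neg_sq]
      exact pow_le_pow_left₀ (norm_nonneg _) (hA s t h) 2
    · rw [norm_sub_rev]
      exact pow_le_pow_left₀ (norm_nonneg _) (hA t s h) 2
  set m : ℝ × ℝ → EuclideanSpace ℝ (Fin 2) := fun x => !₂[x.1, Real.sinh r₁ * A x.2] with hm
  have h1 : μHE[2] (coneShell p u r₀ r₁ a b) ≤
      ((Real.cosh (r₁ - r₀)).toNNReal : ℝ≥0∞) ^ 2 *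
        μHE[2] (m '' (Set.Icc r₀ r₁ ×ˢ Set.Icc a b)) := by
    apply euclideanHausdorffMeasure_image_le
    rintro ⟨r, s⟩ ⟨hr, hs⟩ ⟨r', s'⟩ ⟨hr', hs'⟩
    simp only [Set.mem_Icc] at hr hs hr' hs'
    apply le_of_sq_le_sq _ (by positivity)
    rw [mul_pow]
    have h2 := dist_ofChart_sq_le p (hu s) (hu s') (h := r₁ - r₀) (r := r) (r' := r') (R := r₁)
      (by rw [abs_le]; constructor <;> linarith) (by linarith) (by linarith) hr.2 hr'.2
    refine h2.trans ?_
    rw [Real.coe_toNNReal _ (Real.cosh_pos _).le]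
    gcongr
    rw [EuclideanSpace.dist_eq, Real.sq_sqrt (by positivity)]
    simp only [hm, Fin.sum_univ_two, Real.dist_eq, sq_abs]
    simp only [Matrix.cons_val_zero, Matrix.cons_val_one]
    rw [← mul_sub, mul_pow, mul_pow]
    exact add_le_add_right (mul_le_mul_of_nonneg_left (hA' s s') (sq_nonneg _)) _
  have h2 : m '' (Set.Icc r₀ r₁ ×ˢ Set.Icc a b) ⊆
      {x | x 0 ∈ Set.Icc r₀ r₁ ∧ x 1 ∈ Set.Icc (Real.sinh r₁ * A a) (Real.sinh r₁ * A b)} := by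
    rintro _ ⟨⟨r, s⟩, ⟨hr, hs⟩, rfl⟩
    simp only [Set.mem_Icc] at hr hs
    simp only [hm, Set.mem_ofPred_eq, Set.mem_Icc]
    simp only [Matrix.cons_val_zero, Matrix.cons_val_one]
    exact ⟨hr, mul_le_mul_of_nonneg_left (hmono hs.1) hs1,
      mul_le_mul_of_nonneg_left (hmono hs.2) hs1⟩
  have h3 := measure_mono (μ := (μHE[2] : Measure (EuclideanSpace ℝ (Fin 2)))) h2
  rw [EuclideanSpace.euclideanHausdorffMeasure_eq_volume, volume_box] at h3
  refine h1.trans ?_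
  rw [EuclideanSpace.euclideanHausdorffMeasure_eq_volume]
  refine (mul_le_mul_right h3 _).trans (le_of_eq ?_)
  rw [← ENNReal.ofReal_mul (by linarith), ← ENNReal.coe_pow, ← ENNReal.ofReal_coe_nnreal,
    ← ENNReal.ofReal_mul (by positivity)]
  congr 1
  push_cast
  rw [Real.coe_toNNReal _ (Real.cosh_pos _).le]
  ring

/-- The area of a thin cone is at most the integral of `sinh` over its radius, times its width:
divide it into thin shells. -/
theorem measure_coneShell_le (p : Hyp3) {u : ℝ → EuclideanSpace ℝ (Fin 3)} {A : ℝ → ℝ}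
    {a b M : ℝ} (hM : 0 ≤ M) (hab : a ≤ b) (hu : ∀ s, ‖u s‖ = 1)
    (hA : ∀ s t, s ≤ t → ‖u s - u t‖ ≤ A t - A s) :
    μHE[2] (coneShell p u 0 M a b) ≤ ENNReal.ofReal ((Real.cosh M - 1) * (A b - A a)) := by
  have hAab : 0 ≤ A b - A a := (norm_nonneg _).trans (hA a b hab)
  have key : ∀ n : ℕ, μHE[2] (coneShell p u 0 M a b) ≤
      ENNReal.ofReal (Real.cosh (M / (n + 1)) ^ 2 *
        (Real.cosh M - 1 + M / (n + 1) * Real.sinh M) * (A b - A a)) := by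
    intro n
    set h := M / (n + 1) with hh
    have h0 : 0 ≤ h := by positivity
    have hn : ((n + 1 : ℕ) : ℝ) * h = M := by rw [hh]; push_cast; field_simp
    have hcov : coneShell p u 0 M a b ⊆
        ⋃ k ∈ Finset.range (n + 1), coneShell p u (k * h) ((k + 1 : ℕ) * h) a b := by
      rintro _ ⟨⟨r, s⟩, ⟨hr, hs⟩, rfl⟩
      have hex : ∃ k ∈ Finset.range (n + 1), r ∈ Set.Icc (k * h) ((k + 1 : ℕ) * h) := by
        have : ∀ N : ℕ, r ≤ ((N + 1 : ℕ) : ℝ) * h →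
            ∃ k ∈ Finset.range (N + 1), r ∈ Set.Icc (k * h) ((k + 1 : ℕ) * h) := by
          intro N
          induction N with
          | zero => intro hN; exact ⟨0, by simp, by simpa using hr.1, hN⟩
          | succ N ih =>
            intro hN
            by_cases hc : r ≤ ((N + 1 : ℕ) : ℝ) * h
            · obtain ⟨k, hk, hk'⟩ := ih hc
              exact ⟨k, Finset.range_mono (by lia) hk, hk'⟩
            · exact ⟨N + 1, by simp, le_of_not_ge hc, hN⟩
        exact this n (by rw [hn]; exact hr.2)
      obtain ⟨k, hk, hk'⟩ := hex
      simp only [Set.mem_iUnion]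
      exact ⟨k, hk, ⟨r, s⟩, ⟨hk', hs⟩, rfl⟩
    refine (measure_mono hcov).trans ((measure_biUnion_finset_le _ _).trans ?_)
    have hk : ∀ k ∈ Finset.range (n + 1), μHE[2] (coneShell p u (k * h) ((k + 1 : ℕ) * h) a b) ≤
        ENNReal.ofReal (Real.cosh h ^ 2 * (h * Real.sinh ((k + 1 : ℕ) * h)) * (A b - A a)) := by
      intro k _
      have h1 := measure_coneShell_le_rectangle p (a := a) (b := b) (r₀ := k * h)
        (r₁ := (k + 1 : ℕ) * h) (by positivity) (by push_cast; linarith) hu hA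
      rwa [show ((k + 1 : ℕ) : ℝ) * h - k * h = h by push_cast; ring] at h1
    refine (Finset.sum_le_sum hk).trans ?_
    rw [← ENNReal.ofReal_sum_of_nonneg]
    swap
    · intro k _
      have : 0 ≤ Real.sinh ((k + 1 : ℕ) * h) := Real.sinh_nonneg_iff.2 (by positivity)
      positivity
    apply ENNReal.ofReal_le_ofReal
    rw [← Finset.sum_mul, ← Finset.mul_sum]
    gcongr
    -- The sum of the `h * sinh` telescopes up to an error of `h * sinh M`.
    have hstep : ∀ k : ℕ, h * Real.sinh ((k + 1 : ℕ) * h) ≤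
        (Real.cosh ((k + 1 : ℕ) * h) + h * Real.sinh ((k + 1 : ℕ) * h)) -
        (Real.cosh (k * h) + h * Real.sinh (k * h)) := by
      intro k
      have e : ((k + 1 : ℕ) : ℝ) * h = k * h + h := by push_cast; ring
      have h1 : h ≤ Real.sinh h := Real.self_le_sinh_iff.2 h0
      have h2 : 0 ≤ Real.sinh (k * h) := Real.sinh_nonneg_iff.2 (by positivity)
      rw [e, Real.cosh_add]
      nlinarith [Real.one_le_cosh h, Real.cosh_pos (k * h), mul_le_mul_of_nonneg_right h1 h2]
    refine (Finset.sum_le_sum fun k _ => hstep k).trans (le_of_eq ?_)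
    rw [Finset.sum_range_sub (fun k : ℕ => Real.cosh (k * h) + h * Real.sinh (k * h)), hn]
    simp
    ring
  have hlim : Filter.Tendsto (fun n : ℕ => ENNReal.ofReal (Real.cosh (M / (n + 1)) ^ 2 *
        (Real.cosh M - 1 + M / (n + 1) * Real.sinh M) * (A b - A a))) Filter.atTop
      (nhds (ENNReal.ofReal ((Real.cosh M - 1) * (A b - A a)))) := by
    apply ENNReal.tendsto_ofReal
    have h1 : Filter.Tendsto (fun n : ℕ => M / ((n : ℝ) + 1)) Filter.atTop (nhds 0) := by
      have h0 := (tendsto_one_div_add_atTop_nhds_zero_nat (𝕜 := ℝ)).const_mul M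
      simpa only [mul_one_div, mul_zero] using h0
    have h2 : Continuous fun x : ℝ => Real.cosh x ^ 2 *
        (Real.cosh M - 1 + x * Real.sinh M) * (A b - A a) := by fun_prop
    have h3 := (h2.tendsto 0).comp h1
    simp only [Function.comp_def, Real.cosh_zero, one_pow, one_mul, zero_mul, add_zero] at h3
    exact h3
  exact ge_of_tendsto' hlim key

/-! ### Area with multiplicity -/

/-- If the domain is covered by finitely many pieces for each `n`, and the points of a fibre
eventually lie in different pieces, then the measure of the image, counted with multiplicity, is at
most any eventual bound of the sums of the measures of the images of the pieces. This is Fatou's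
lemma for the number of pieces whose image contains a given point. -/
theorem lintegral_encard_fibre_le {X Y : Type*} [MeasurableSpace Y] {μ : Measure Y} {f : X → Y}
    {B : Set X} {N : ℕ → ℕ} {A : ℕ → ℕ → Set X} {C : ℝ≥0∞}
    (hm : ∀ n i, MeasurableSet (f '' A n i)) (hcov : ∀ n, ∀ z ∈ B, ∃ i < N n, z ∈ A n i)
    (hsep : ∀ z ∈ B, ∀ w ∈ B, z ≠ w → f z = f w →
      ∀ᶠ n in Filter.atTop, ∀ i, ¬ (z ∈ A n i ∧ w ∈ A n i))
    (hC : ∀ᶠ n in Filter.atTop, ∑ i ∈ Finset.range (N n), μ (f '' A n i) ≤ C) :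
    ∫⁻ y, ((({z ∈ B | f z = y}).encard : ℕ∞) : ℝ≥0∞) ∂μ ≤ C := by
  classical
  set F : ℕ → Y → ℝ≥0∞ := fun n y => ∑ i ∈ Finset.range (N n), (f '' A n i).indicator 1 y with hF
  have hFm : ∀ n, Measurable (F n) := fun n =>
    Finset.measurable_sum _ fun i _ => measurable_one.indicator (hm n i)
  have hFi : ∀ n, ∫⁻ y, F n y ∂μ = ∑ i ∈ Finset.range (N n), μ (f '' A n i) := by
    intro n
    rw [lintegral_finsetSum _ fun i _ => measurable_one.indicator (hm n i)]
    exact Finset.sum_congr rfl fun i _ => lintegral_indicator_one (hm n i)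
  have hk : ∀ (y : Y) (k : ℕ), (k : ℕ∞) ≤ ({z ∈ B | f z = y}).encard →
      (k : ℝ≥0∞) ≤ Filter.liminf (fun n => F n y) Filter.atTop := by
    intro y k hk
    obtain ⟨T, hT, hTk⟩ := Set.exists_subset_encard_eq hk
    have hfin : T.Finite := Set.finite_of_encard_eq_coe hTk
    have hev : ∀ᶠ n in Filter.atTop, ∀ z ∈ T, ∀ w ∈ T, z ≠ w →
        ∀ i, ¬ (z ∈ A n i ∧ w ∈ A n i) := by
      rw [Filter.eventually_all_finite hfin]
      intro z hz
      rw [Filter.eventually_all_finite hfin]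
      intro w hw
      by_cases hzw : z = w
      · simp [hzw]
      · filter_upwards [hsep z (hT hz).1 w (hT hw).1 hzw
          ((hT hz).2.trans (hT hw).2.symm)] with n hn _ using hn
    refine Filter.le_liminf_of_le (by isBoundedDefault) ?_
    filter_upwards [hev] with n hn
    choose! c hcN hcA using fun z (hz : z ∈ T) => hcov n z (hT hz).1
    have hinj : Set.InjOn c hfin.toFinset := by
      intro z hz w hw h
      rw [hfin.coe_toFinset] at hz hw
      by_contra hne
      exact hn z hz w hw hne (c z) ⟨hcA z hz, h ▸ hcA w hw⟩
    have hcard : (hfin.toFinset.image c).card = k := by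
      rw [Finset.card_image_of_injOn hinj]
      have := hfin.encard_eq_coe_toFinset_card
      rw [hTk] at this
      exact_mod_cast this.symm
    calc (k : ℝ≥0∞) = ∑ i ∈ hfin.toFinset.image c, 1 := by rw [Finset.sum_const, hcard]; simp
      _ ≤ ∑ i ∈ hfin.toFinset.image c, (f '' A n i).indicator 1 y := by
        refine Finset.sum_le_sum fun i hi => ?_
        obtain ⟨z, hz, rfl⟩ := Finset.mem_image.1 hi
        rw [hfin.mem_toFinset] at hz
        have hy : y ∈ f '' A n (c z) := ⟨z, hcA z hz, (hT hz).2⟩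
        simp [Set.indicator_of_mem hy]
      _ ≤ F n y := by
        refine Finset.sum_le_sum_of_subset fun i hi => ?_
        obtain ⟨z, hz, rfl⟩ := Finset.mem_image.1 hi
        rw [hfin.mem_toFinset] at hz
        exact Finset.mem_range.2 (hcN z hz)
  have hpt : ∀ y, ((({z ∈ B | f z = y}).encard : ℕ∞) : ℝ≥0∞) ≤
      Filter.liminf (fun n => F n y) Filter.atTop := by
    intro y
    rcases eq_or_ne ({z ∈ B | f z = y}).encard ⊤ with h | h
    · have : ∀ k : ℕ, (k : ℝ≥0∞) ≤ Filter.liminf (fun n => F n y) Filter.atTop := fun k =>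
        hk y k (h ▸ le_top)
      rw [h, ENat.toENNReal_top, top_le_iff]
      exact ENNReal.eq_top_of_forall_nnreal_le fun r => by
        obtain ⟨k, hk⟩ := exists_nat_ge r
        exact le_trans (by exact_mod_cast hk) (this k)
    · obtain ⟨k, hk'⟩ := ENat.ne_top_iff_exists.1 h
      have := hk y k hk'.le
      rw [← hk']
      simpa using this
  calc ∫⁻ y, ((({z ∈ B | f z = y}).encard : ℕ∞) : ℝ≥0∞) ∂μ
      ≤ ∫⁻ y, Filter.liminf (fun n => F n y) Filter.atTop ∂μ := lintegral_mono hpt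
    _ ≤ Filter.liminf (fun n => ∫⁻ y, F n y ∂μ) Filter.atTop := lintegral_liminf_le hFm
    _ ≤ C := by
      refine Filter.liminf_le_of_frequently_le' ?_
      refine Filter.Eventually.frequently ?_
      filter_upwards [hC] with n hn
      rw [hFi]
      exact hn

/-! ### The geodesic cone -/

/-- The geodesic cone with apex `p` over the closed curve `γ` of length `L`, parametrized by the
unit disk: the radius of the disk at the angle `2 π s / L` is mapped to the geodesic segment
from `p` to `γ s`. -/
noncomputable def coneDisk (p : Hyp3) (γ : ℝ → Hyp3) (L : ℝ) (z : ℂ) : Hyp3 :=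
  ofChart p (‖z‖ • chart p (γ (L * z.arg / (2 * Real.pi))).pos)

/-- Polar coordinates of the disk, with the arc length of the boundary curve for the angle. -/
noncomputable def diskPolar (L : ℝ) (x : ℝ × ℝ) : ℂ :=
  x.1 * Complex.exp ((2 * Real.pi * x.2 / L : ℝ) * Complex.I)

theorem norm_diskPolar (L : ℝ) {τ : ℝ} (hτ : 0 ≤ τ) (s : ℝ) : ‖diskPolar L (τ, s)‖ = τ := by
  simp only [diskPolar, norm_mul, Complex.norm_exp_ofReal_mul_I, Complex.norm_real, mul_one,
    Real.norm_eq_abs, abs_of_nonneg hτ]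

theorem continuous_diskPolar (L : ℝ) : Continuous (diskPolar L) := by
  unfold diskPolar; fun_prop

theorem diskPolar_add_length {L : ℝ} (hL : 0 < L) (τ s : ℝ) :
    diskPolar L (τ, s + L) = diskPolar L (τ, s) := by
  simp only [diskPolar]
  congr 1
  rw [Complex.exp_eq_exp_iff_exists_int]
  refine ⟨1, ?_⟩
  have : (L : ℂ) ≠ 0 := by exact_mod_cast hL.ne'
  push_cast
  field_simp

theorem diskPolar_arg {L : ℝ} (hL : 0 < L) (z : ℂ) :
    diskPolar L (‖z‖, L * z.arg / (2 * Real.pi)) = z := by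
  have hπ := Real.pi_pos
  simp only [diskPolar]
  rw [show 2 * Real.pi * (L * z.arg / (2 * Real.pi)) / L = z.arg by field_simp]
  exact Complex.norm_mul_exp_arg_mul_I z

theorem exists_diskPolar {L : ℝ} (hL : 0 < L) (z : ℂ) :
    ∃ s ∈ Set.Ico 0 L, diskPolar L (‖z‖, s) = z := by
  have hπ := Real.pi_pos
  have h1 := Complex.neg_pi_lt_arg z
  have h2 := Complex.arg_le_pi z
  rcases lt_or_ge z.arg 0 with h | h
  · refine ⟨L * z.arg / (2 * Real.pi) + L, ⟨?_, ?_⟩, ?_⟩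
    · have : -L ≤ L * z.arg / (2 * Real.pi) := by
        rw [le_div_iff₀ (by positivity)]; nlinarith
      linarith
    · have : L * z.arg / (2 * Real.pi) < 0 := by
        apply div_neg_of_neg_of_pos _ (by positivity)
        nlinarith
      linarith
    · rw [diskPolar_add_length hL, diskPolar_arg hL]
  · refine ⟨L * z.arg / (2 * Real.pi), ⟨by positivity, ?_⟩, diskPolar_arg hL z⟩
    rw [div_lt_iff₀ (by positivity)]
    nlinarith

theorem coneDisk_diskPolar {L : ℝ} (hL : 0 < L) {γ : ℝ → Hyp3} (hγ : Function.Periodic γ L)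
    (p : Hyp3) {τ : ℝ} (hτ : 0 ≤ τ) (s : ℝ) :
    coneDisk p γ L (diskPolar L (τ, s)) = ofChart p (τ • chart p (γ s).pos) := by
  rw [coneDisk, norm_diskPolar L hτ]
  rcases hτ.eq_or_lt with rfl | hτ
  · simp
  congr 4
  have h : ((Complex.arg (diskPolar L (τ, s)) : ℝ) : Real.Angle) = (2 * Real.pi * s / L : ℝ) := by
    rw [diskPolar, Complex.exp_mul_I, ← Complex.ofReal_cos, ← Complex.ofReal_sin]
    exact Complex.arg_mul_cos_add_sin_mul_I_coe_angle hτ (2 * Real.pi * s / L : ℝ)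
  rw [Real.Angle.angle_eq_iff_two_pi_dvd_sub] at h
  obtain ⟨k, hk⟩ := h
  have hπ := Real.pi_pos
  have : L * (diskPolar L (τ, s)).arg / (2 * Real.pi) = s + k * L := by
    rw [sub_eq_iff_eq_add] at hk
    rw [hk]
    field_simp
    ring
  rw [this]
  exact (hγ.int_mul k) s

theorem continuous_cone_polar {γ : ℝ → Hyp3} (hγ : Continuous γ) (p : Hyp3) :
    Continuous fun x : ℝ × ℝ => ofChart p (x.1 • chart p (γ x.2).pos) := by
  have h : Continuous fun x : ℝ × ℝ => chart p (γ x.2).pos :=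
    (continuous_chart p).comp (continuous_pos.comp (hγ.comp continuous_snd))
  exact (continuous_ofChart p).comp (continuous_fst.smul h)

theorem continuousOn_coneDisk {L : ℝ} (hL : 0 < L) {γ : ℝ → Hyp3} (hγ : Function.Periodic γ L)
    (hc : Continuous γ) (p : Hyp3) : ContinuousOn (coneDisk p γ L) (Metric.closedBall 0 1) := by
  -- Polar coordinates are a closed map of a compact rectangle onto the disk.
  rw [continuousOn_iff_isClosed]
  intro t ht
  refine ⟨diskPolar L '' ((Set.Icc 0 1 ×ˢ Set.Icc 0 L) ∩
    (fun x : ℝ × ℝ => ofChart p (x.1 • chart p (γ x.2).pos)) ⁻¹' t), ?_, ?_⟩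
  · refine (IsCompact.image ?_ (continuous_diskPolar L)).isClosed
    exact (isCompact_Icc.prod isCompact_Icc).inter_right
      (ht.preimage (continuous_cone_polar hc p))
  · ext z
    constructor
    · rintro ⟨hz, hz1⟩
      obtain ⟨s, hs, hsz⟩ := exists_diskPolar hL z
      refine ⟨⟨(‖z‖, s), ⟨⟨⟨norm_nonneg _, by simpa using hz1⟩, hs.1, hs.2.le⟩, ?_⟩, hsz⟩, hz1⟩
      rw [Set.mem_preimage, ← hsz, coneDisk_diskPolar hL hγ p (norm_nonneg _)] at hz
      exact hz
    · rintro ⟨⟨⟨τ, s⟩, ⟨⟨hτ, hs⟩, hx⟩, rfl⟩, hz1⟩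
      refine ⟨?_, hz1⟩
      rw [Set.mem_preimage, coneDisk_diskPolar hL hγ p hτ.1]
      exact hx

/-- No point of the curve is a combination `a • p + b • γ s` with `a > 0` and `b ≥ 0`; that is, `p`
is off the curve, and every geodesic ray from `p` meets the curve in at most one point (which may
be the value of the curve at several parameters). -/
def SeesOnce (p : Hyp3) (γ : ℝ → Hyp3) : Prop :=
  ∀ s t a b : ℝ, 0 ≤ a → 0 ≤ b → (γ t).pos = a • p.pos + b • (γ s).pos → a = 0

theorem SeesOnce.ne {p : Hyp3} {γ : ℝ → Hyp3} (h : SeesOnce p γ) (t : ℝ) : p ≠ γ t := by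
  intro hp
  have := h t t 1 0 zero_le_one le_rfl (by simp [hp])
  exact one_ne_zero this

theorem SeesOnce.dist_pos {p : Hyp3} {γ : ℝ → Hyp3} (h : SeesOnce p γ) (t : ℝ) :
    0 < dist p (γ t) := _root_.dist_pos.2 (h.ne t)

theorem SeesOnce.chart_ne_zero {p : Hyp3} {γ : ℝ → Hyp3} (h : SeesOnce p γ) (t : ℝ) :
    chart p (γ t).pos ≠ 0 := by
  rw [← norm_pos_iff, norm_chart_eq_sinh]
  exact Real.sinh_pos_iff.2 (h.dist_pos t)

theorem SeesOnce.eq_of_smul_eq {p : Hyp3} {γ : ℝ → Hyp3} (h : SeesOnce p γ) {s t b : ℝ}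
    (hb0 : 0 ≤ b) (hb1 : b ≤ 1) (he : chart p (γ t).pos = b • chart p (γ s).pos) : γ t = γ s := by
  rcases hb1.eq_or_lt with rfl | hb1
  · exact chart_injective p _ _ (by simpa using he)
  exfalso
  have h1 := ofChart_smul_chart p (γ s) b
  rw [← he, ofChart_chart, he] at h1
  have h2 := apex_coeff_pos p (γ s) b hb0 hb1
  exact h2.ne' (h s t _ _ h2.le hb0 h1)

theorem isDiskBoundedBy_coneDisk {L : ℝ} (hL : 0 < L) {γ : ℝ → Hyp3}
    (hγ : Function.Periodic γ L) (hc : Continuous γ) {p : Hyp3} (hp : SeesOnce p γ) :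
    IsDiskBoundedBy (coneDisk p γ L) γ L where
  continuousOn := continuousOn_coneDisk hL hγ hc p
  boundary s := by
    have h : ((Circle.exp (2 * Real.pi * s / L) : Circle) : ℂ) = diskPolar L (1, s) := by
      rw [Circle.coe_exp, diskPolar]; simp
    rw [h, coneDisk_diskPolar hL hγ p zero_le_one, one_smul, ofChart_chart]
  embedded hinj := by
    -- Two points of the disk with the same image are on the same radius.
    have key : ∀ z w : ℂ, ‖z‖ ≤ ‖w‖ → coneDisk p γ L z = coneDisk p γ L w → z = w := by
      intro z w hzw h
      obtain ⟨s, hs, hsz⟩ := exists_diskPolar hL z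
      obtain ⟨t, ht, htw⟩ := exists_diskPolar hL w
      rw [← hsz, ← htw, coneDisk_diskPolar hL hγ p (norm_nonneg _),
        coneDisk_diskPolar hL hγ p (norm_nonneg _)] at h
      have h1 := ofChart_injective p h
      rcases (norm_nonneg z).eq_or_lt with hz | hz
      · rw [← hz, zero_smul, eq_comm, smul_eq_zero] at h1
        have h2 := h1.resolve_right (hp.chart_ne_zero t)
        rw [norm_eq_zero.1 hz.symm, norm_eq_zero.1 h2]
      have hw : 0 < ‖w‖ := hz.trans_le hzw
      have h2 : chart p (γ t).pos = (‖w‖⁻¹ * ‖z‖) • chart p (γ s).pos := by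
        rw [mul_smul, h1, inv_smul_smul₀ hw.ne']
      have h3 := hp.eq_of_smul_eq (by positivity)
        (by rw [inv_mul_le_iff₀ hw, mul_one]; exact hzw) h2
      have h4 : t = s := hinj ht hs h3
      subst h4
      have h5 : ‖z‖ = ‖w‖ := smul_left_injective ℝ (hp.chart_ne_zero t) h1
      rw [← hsz, ← htw, h5]
    intro z _ w _ h
    rcases le_total ‖z‖ ‖w‖ with hzw | hzw
    · exact key z w hzw h
    · exact (key w z hzw h.symm).symm

/-- The part of the geodesic cone from `p` over the arc of `γ` with parameters in `[a, b]`. -/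
def coneArc (p : Hyp3) (γ : ℝ → Hyp3) (a b : ℝ) : Set Hyp3 :=
  (fun x : ℝ × ℝ => ofChart p (x.1 • chart p (γ x.2).pos)) '' (Set.Icc 0 1 ×ˢ Set.Icc a b)

theorem exists_mem_arc {L : ℝ} {s : ℝ} (hs : s ∈ Set.Ico 0 L) (n : ℕ) :
    ∃ i < n + 1, s ∈ Set.Icc ((i : ℝ) * (L / (n + 1 : ℕ))) ((i + 1 : ℕ) * (L / (n + 1 : ℕ))) := by
  have hL : 0 < L := hs.1.trans_lt hs.2
  have hd : 0 < L / (n + 1 : ℕ) := by positivity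
  refine ⟨⌊s / (L / (n + 1 : ℕ))⌋₊, ?_, ?_, ?_⟩
  · rw [Nat.floor_lt (div_nonneg hs.1 hd.le), div_lt_iff₀ hd]
    have : ((n + 1 : ℕ) : ℝ) * (L / (n + 1 : ℕ)) = L := by field_simp
    rw [this]; exact hs.2
  · rw [← le_div_iff₀ hd]
    exact Nat.floor_le (div_nonneg hs.1 hd.le)
  · rw [← div_le_iff₀ hd]
    push_cast
    exact (Nat.lt_floor_add_one _).le

/-- The area of a cone is at most any eventual bound of the sums of the areas
of its sectors. -/
theorem diskArea_coneDisk_le {L : ℝ} (hL : 0 < L) {γ : ℝ → Hyp3}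
    (hγ : Function.Periodic γ L) (hc : Continuous γ) {p : Hyp3} (hp : SeesOnce p γ) {C : ℝ≥0∞}
    (hC : ∀ᶠ n : ℕ in Filter.atTop, ∑ i ∈ Finset.range (n + 1),
      μHE[2] (coneArc p γ (i * (L / (n + 1 : ℕ))) ((i + 1 : ℕ) * (L / (n + 1 : ℕ)))) ≤ C) :
    diskArea (coneDisk p γ L) ≤ C := by
  have himg : ∀ n i : ℕ, coneDisk p γ L '' (diskPolar L '' (Set.Icc 0 1 ×ˢ
      Set.Icc ((i : ℝ) * (L / (n + 1 : ℕ))) ((i + 1 : ℕ) * (L / (n + 1 : ℕ))))) =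
      coneArc p γ (i * (L / (n + 1 : ℕ))) ((i + 1 : ℕ) * (L / (n + 1 : ℕ))) := by
    intro n i
    rw [Set.image_image, coneArc]
    refine Set.image_congr ?_
    rintro ⟨τ, s⟩ ⟨hτ, _⟩
    exact coneDisk_diskPolar hL hγ p hτ.1 s
  refine lintegral_encard_fibre_le (N := fun n => n + 1) (A := fun n i => diskPolar L ''
    (Set.Icc 0 1 ×ˢ Set.Icc ((i : ℝ) * (L / (n + 1 : ℕ))) ((i + 1 : ℕ) * (L / (n + 1 : ℕ)))))
    ?_ ?_ ?_ ?_
  · intro n i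
    rw [himg]
    exact ((isCompact_Icc.prod isCompact_Icc).image (continuous_cone_polar hc p)).measurableSet
  · intro n z hz
    obtain ⟨s, hs, hsz⟩ := exists_diskPolar hL z
    obtain ⟨i, hi, hsi⟩ := exists_mem_arc hs n
    exact ⟨i, hi, (‖z‖, s), ⟨⟨norm_nonneg _, by simpa using hz⟩, hsi⟩, hsz⟩
  · -- Points of the same fibre are on different radii, which the thin sectors separate.
    intro z _ w _ hzw hf
    have hz0 : ∀ z w : ℂ, z ≠ w → coneDisk p γ L z = coneDisk p γ L w → w ≠ 0 := by
      rintro z w hzw hf rfl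
      have h1 := ofChart_injective p hf
      rw [norm_zero, zero_smul, smul_eq_zero] at h1
      exact hzw (norm_eq_zero.1 (h1.resolve_right (hp.chart_ne_zero _)))
    have hw := hz0 z w hzw hf
    have hz := hz0 w z hzw.symm hf.symm
    have hne : z / ‖z‖ ≠ w / ‖w‖ := by
      intro h
      have hz' : (‖z‖ : ℂ) ≠ 0 := by exact_mod_cast norm_ne_zero_iff.2 hz
      have hw' : (‖w‖ : ℂ) ≠ 0 := by exact_mod_cast norm_ne_zero_iff.2 hw
      have harg : z.arg = w.arg := by
        rw [div_eq_div_iff hz' hw'] at h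
        have h1 := Complex.arg_mul_real (norm_pos_iff.2 hw) z
        rw [h, Complex.arg_mul_real (norm_pos_iff.2 hz)] at h1
        exact h1.symm
      have h1 := ofChart_injective p hf
      rw [harg] at h1
      have h2 : ‖z‖ = ‖w‖ := smul_left_injective ℝ (hp.chart_ne_zero _) h1
      rw [h2] at h
      exact hzw ((div_left_inj' hw').1 h)
    have hd : 0 < ‖z / ‖z‖ - w / ‖w‖‖ := norm_pos_iff.2 (sub_ne_zero.2 hne)
    have hlim : Filter.Tendsto (fun n : ℕ => 2 * Real.pi * (1 / ((n : ℝ) + 1))) Filter.atTop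
        (nhds 0) := by
      have h0 := (tendsto_one_div_add_atTop_nhds_zero_nat (𝕜 := ℝ)).const_mul (2 * Real.pi)
      rwa [mul_zero] at h0
    filter_upwards [hlim.eventually_lt_const hd] with n hn i
    rintro ⟨⟨⟨τ, s⟩, ⟨hτ, hs⟩, rfl⟩, ⟨⟨τ', s'⟩, ⟨hτ', hs'⟩, rfl⟩⟩
    have hdir : ∀ (τ s : ℝ), 0 ≤ τ → diskPolar L (τ, s) ≠ 0 →
        diskPolar L (τ, s) / ‖diskPolar L (τ, s)‖ =
          Complex.exp ((2 * Real.pi * s / L : ℝ) * Complex.I) := by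
      intro τ s hτ h0
      rw [norm_diskPolar L hτ]
      have : (τ : ℂ) ≠ 0 := by
        rintro h
        exact h0 (by simp [diskPolar, h])
      simp only [diskPolar]
      field_simp
    rw [hdir τ s hτ.1 hz, hdir τ' s' hτ'.1 hw] at hn
    apply hn.not_ge
    have h1 : ‖Complex.exp ((2 * Real.pi * s / L : ℝ) * Complex.I) -
        Complex.exp ((2 * Real.pi * s' / L : ℝ) * Complex.I)‖ ≤
        |2 * Real.pi * s / L - 2 * Real.pi * s' / L| := by
      have h2 : Complex.exp ((2 * Real.pi * s / L : ℝ) * Complex.I) -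
        Complex.exp ((2 * Real.pi * s' / L : ℝ) * Complex.I) =
        Complex.exp ((2 * Real.pi * s' / L : ℝ) * Complex.I) *
        (Complex.exp (Complex.I * (2 * Real.pi * s / L - 2 * Real.pi * s' / L : ℝ)) - 1) := by
        rw [mul_sub, ← Complex.exp_add, mul_one]
        congr 2
        push_cast
        ring
      rw [h2, norm_mul, Complex.norm_exp_ofReal_mul_I, one_mul]
      exact Real.norm_exp_I_mul_ofReal_sub_one_le
    refine h1.trans ?_
    simp only [Set.mem_Icc] at hs hs'
    have e : 2 * Real.pi * s / L - 2 * Real.pi * s' / L = 2 * Real.pi / L * (s - s') := by ring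
    have h3 : |s - s'| ≤ L / (n + 1 : ℕ) := by
      have e2 : ((i + 1 : ℕ) : ℝ) * (L / (n + 1 : ℕ)) =
          i * (L / (n + 1 : ℕ)) + L / (n + 1 : ℕ) := by
        push_cast; ring
      rw [abs_le]
      constructor <;> linarith
    have hπ := Real.pi_pos
    rw [e, abs_mul, abs_of_pos (by positivity)]
    refine (mul_le_mul_of_nonneg_left h3 (by positivity)).trans (le_of_eq ?_)
    push_cast
    field_simp
  · filter_upwards [hC] with n hn
    simpa only [himg] using hn

/-! ### Sums along chains of parameters -/

/-- `ChainSum X a b S`: the number `S` is the sum of the values of `X` on the successive pairs of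
some increasing finite chain of parameters from `a` to `b`. -/
inductive ChainSum (X : ℝ → ℝ → ℝ) (a : ℝ) : ℝ → ℝ → Prop
  | nil : ChainSum X a a 0
  | step {b c S : ℝ} : ChainSum X a b S → b ≤ c → ChainSum X a c (S + X b c)

theorem ChainSum.le {X : ℝ → ℝ → ℝ} {a b S : ℝ} (h : ChainSum X a b S) : a ≤ b := by
  induction h with
  | nil => exact le_rfl
  | step _ h1 ih => exact ih.trans h1

theorem ChainSum.trans {X : ℝ → ℝ → ℝ} {a b c S T : ℝ} (h : ChainSum X a b S)
    (h' : ChainSum X b c T) : ChainSum X a c (S + T) := by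
  induction h' with
  | nil => simpa using h
  | step _ h1 ih => rw [← add_assoc]; exact ih.step h1

theorem ChainSum.eq_sub {X : ℝ → ℝ → ℝ} {G : ℝ → ℝ} (hX : ∀ s t, s ≤ t → X s t = G t - G s)
    {a b S : ℝ} (h : ChainSum X a b S) : S = G b - G a := by
  induction h with
  | nil => simp
  | step _ h1 ih => rw [ih, hX _ _ h1]; ring

/-- A function `X` of pairs that dominates `c` times the chord of a curve has chain sums that
are almost `c` times the variation. -/
theorem exists_chainSum_ge {E : Type*} [PseudoMetricSpace E] {u : ℝ → E} {X : ℝ → ℝ → ℝ}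
    {a b c : ℝ} (hab : a ≤ b) (hc : 0 ≤ c) (hX : ∀ s t, a ≤ s → s ≤ t → t ≤ b →
      c * dist (u s) (u t) ≤ X s t) {e : ℝ} (he : 0 < e) :
    ∃ S, ChainSum X a b S ∧ c * (eVariationOn u (Set.Icc a b)).toReal - e ≤ S := by
  set V := eVariationOn u (Set.Icc a b) with hV
  have hX0 : ∀ s t, a ≤ s → s ≤ t → t ≤ b → 0 ≤ X s t := fun s t h1 h2 h3 =>
    (mul_nonneg hc dist_nonneg).trans (hX s t h1 h2 h3)
  have hex : ∃ p : ℕ × { v : ℕ → ℝ // Monotone v ∧ ∀ i, v i ∈ Set.Icc a b },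
      V.toReal - e / (c + 1) ≤
        ∑ i ∈ Finset.range p.1, dist (u (p.2.1 (i + 1))) (u (p.2.1 i)) := by
    by_contra! hcon
    have h0 : V ≤ ENNReal.ofReal (V.toReal - e / (c + 1)) := by
      refine iSup_le fun p => ?_
      have h1 := (hcon p).le
      refine le_trans (le_of_eq ?_) (ENNReal.ofReal_le_ofReal h1)
      rw [ENNReal.ofReal_sum_of_nonneg fun _ _ => dist_nonneg]
      exact Finset.sum_congr rfl fun i _ => edist_dist _ _
    have hpos : 0 < V.toReal - e / (c + 1) := by
      have p0 : ℕ × { v : ℕ → ℝ // Monotone v ∧ ∀ i, v i ∈ Set.Icc a b } :=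
        (0, ⟨fun _ => a, monotone_const, fun _ => ⟨le_rfl, hab⟩⟩)
      exact (Finset.sum_nonneg fun _ _ => dist_nonneg).trans_lt (hcon p0)
    have h1 := ENNReal.toReal_mono ENNReal.ofReal_ne_top h0
    rw [ENNReal.toReal_ofReal hpos.le] at h1
    have : 0 < e / (c + 1) := by positivity
    linarith
  obtain ⟨⟨n, v, hv, hvm⟩, hn⟩ := hex
  have hchain : ∀ k, ∃ S, ChainSum X a (v k) S ∧
      c * ∑ i ∈ Finset.range k, dist (u (v (i + 1))) (u (v i)) ≤ S := by
    intro k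
    induction k with
    | zero =>
      refine ⟨_, ChainSum.nil.step (hvm 0).1, ?_⟩
      simpa using hX0 a (v 0) le_rfl (hvm 0).1 (hvm 0).2
    | succ k ih =>
      obtain ⟨S, hS, hle⟩ := ih
      refine ⟨_, hS.step (hv (Nat.le_succ k)), ?_⟩
      rw [Finset.sum_range_succ, mul_add, dist_comm (u (v (k + 1)))]
      exact add_le_add hle (hX _ _ (hvm k).1 (hv (Nat.le_succ k)) (hvm (k + 1)).2)
  obtain ⟨S, hS, hle⟩ := hchain n
  refine ⟨_, hS.step (hvm n).2, ?_⟩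
  have h1 := hX0 (v n) b (hvm n).1 (hvm n).2 le_rfl
  have h2 := mul_le_mul_of_nonneg_left hn hc
  have h3 : c * (e / (c + 1)) ≤ e := by
    rw [mul_div_assoc', div_le_iff₀ (by linarith)]
    nlinarith
  simp only at h2
  rw [mul_sub] at h2
  linarith

/-! ### The direction of a curve as seen from a point -/

/-- The unit vector of the direction in which `p` sees the point `γ s`. -/
noncomputable def direction (p : Hyp3) (γ : ℝ → Hyp3) (s : ℝ) : EuclideanSpace ℝ (Fin 3) :=
  ‖chart p (γ s).pos‖⁻¹ • chart p (γ s).pos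

theorem norm_direction {p : Hyp3} {γ : ℝ → Hyp3} (hp : SeesOnce p γ) (s : ℝ) :
    ‖direction p γ s‖ = 1 := by
  rw [direction, norm_smul, norm_inv, norm_norm,
    inv_mul_cancel₀ (norm_ne_zero_iff.2 (hp.chart_ne_zero s))]

theorem sinh_smul_direction {p : Hyp3} {γ : ℝ → Hyp3} (hp : SeesOnce p γ) (s : ℝ) :
    Real.sinh (dist p (γ s)) • direction p γ s = chart p (γ s).pos := by
  rw [← norm_chart_eq_sinh, direction,
    smul_inv_smul₀ (norm_ne_zero_iff.2 (hp.chart_ne_zero s))]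

theorem cosh_dist_curve {p : Hyp3} {γ : ℝ → Hyp3} (hp : SeesOnce p γ) (s t : ℝ) :
    Real.cosh (dist (γ s) (γ t)) = Real.cosh (dist p (γ s) - dist p (γ t)) +
      Real.sinh (dist p (γ s)) * Real.sinh (dist p (γ t)) *
        (‖direction p γ s - direction p γ t‖ ^ 2 / 2) := by
  rw [← cosh_dist_ofChart p _ _ (norm_direction hp s) (norm_direction hp t),
    sinh_smul_direction hp, sinh_smul_direction hp, ofChart_chart, ofChart_chart]

theorem coneArc_subset {p : Hyp3} {γ : ℝ → Hyp3} (hp : SeesOnce p γ) {a b M : ℝ}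
    (hM : ∀ s ∈ Set.Icc a b, dist p (γ s) ≤ M) :
    coneArc p γ a b ⊆ coneShell p (direction p γ) 0 M a b := by
  rintro _ ⟨⟨τ, s⟩, ⟨hτ, hs⟩, rfl⟩
  have h0 := Real.sinh_nonneg_iff.2 (dist_nonneg (x := p) (y := γ s))
  refine ⟨(Real.arsinh (τ * Real.sinh (dist p (γ s))), s), ⟨⟨?_, ?_⟩, hs⟩, ?_⟩
  · exact Real.arsinh_nonneg_iff.2 (mul_nonneg hτ.1 h0)
  · refine le_trans ?_ (hM s hs)
    rw [← Real.sinh_le_sinh, Real.sinh_arsinh]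
    exact mul_le_of_le_one_left h0 hτ.2
  · simp only [Real.sinh_arsinh, mul_smul, sinh_smul_direction hp]

theorem IsRectifiableClosedCurve.dist_le {γ : ℝ → Hyp3} {L : ℝ}
    (h : IsRectifiableClosedCurve γ L) (s t : ℝ) : dist (γ s) (γ t) ≤ |s - t| := by
  have key : ∀ s t, s ≤ t → dist (γ s) (γ t) ≤ t - s := by
    intro s t hst
    have h1 := h.unitSpeed (Set.mem_univ s) (Set.mem_univ t)
    have h2 := eVariationOn.edist_le γ (s := Set.univ ∩ Set.Icc s t) (x := s) (y := t)
      ⟨Set.mem_univ _, le_rfl, hst⟩ ⟨Set.mem_univ _, hst, le_rfl⟩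
    rw [h1, edist_dist] at h2
    have h3 := (ENNReal.ofReal_le_ofReal_iff (by simpa using hst)).1 h2
    simpa using h3
  rcases le_total s t with hst | hst
  · rw [abs_sub_comm, abs_of_nonneg (by linarith)]
    exact key s t hst
  · rw [dist_comm, abs_of_nonneg (by linarith)]
    exact key t s hst

theorem IsRectifiableClosedCurve.lipschitz {γ : ℝ → Hyp3} {L : ℝ}
    (h : IsRectifiableClosedCurve γ L) : LipschitzWith 1 γ :=
  LipschitzWith.of_dist_le_mul fun s t => by
    simpa [Real.dist_eq] using h.dist_le s t

theorem IsRectifiableClosedCurve.continuous {γ : ℝ → Hyp3} {L : ℝ}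
    (h : IsRectifiableClosedCurve γ L) : Continuous γ := h.lipschitz.continuous

theorem IsRectifiableClosedCurve.exists_eq {γ : ℝ → Hyp3} {L : ℝ}
    (h : IsRectifiableClosedCurve γ L) (s : ℝ) : ∃ t ∈ Set.Icc 0 L, γ s = γ t := by
  obtain ⟨t, ht, he⟩ := h.periodic.exists_mem_Ico₀ h.length_pos s
  exact ⟨t, ⟨ht.1, ht.2.le⟩, he⟩

theorem exists_dist_bounds {γ : ℝ → Hyp3} {L : ℝ} (h : IsRectifiableClosedCurve γ L) {p : Hyp3}
    (hp : SeesOnce p γ) : ∃ r R : ℝ, 0 < r ∧ ∀ s, r ≤ dist p (γ s) ∧ dist p (γ s) ≤ R := by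
  have hne : (Set.Icc 0 L).Nonempty := ⟨0, le_rfl, h.length_pos.le⟩
  have hc : ContinuousOn (fun s => dist p (γ s)) (Set.Icc 0 L) :=
    (continuous_const.dist h.continuous).continuousOn
  obtain ⟨a, _, hmin⟩ := isCompact_Icc.exists_isMinOn hne hc
  obtain ⟨b, _, hmax⟩ := isCompact_Icc.exists_isMaxOn hne hc
  refine ⟨dist p (γ a), dist p (γ b), hp.dist_pos a, fun s => ?_⟩
  obtain ⟨t, ht, he⟩ := h.exists_eq s
  rw [he]
  exact ⟨hmin ht, hmax ht⟩

theorem exists_lipschitz_direction {γ : ℝ → Hyp3} {L : ℝ} (h : IsRectifiableClosedCurve γ L)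
    {p : Hyp3} (hp : SeesOnce p γ) : ∃ C, LipschitzWith C (direction p γ) := by
  obtain ⟨r, R, hr, hrR⟩ := exists_dist_bounds h hp
  have hs : 0 < Real.sinh r := Real.sinh_pos_iff.2 hr
  refine ⟨(max 2 (Real.cosh 1 / Real.sinh r)).toNNReal, LipschitzWith.of_dist_le_mul ?_⟩
  intro s t
  rw [Real.coe_toNNReal _ (le_max_of_le_left zero_le_two), Real.dist_eq, dist_eq_norm]
  rcases le_or_gt 1 |s - t| with h1 | h1
  · calc ‖direction p γ s - direction p γ t‖ ≤ ‖direction p γ s‖ + ‖direction p γ t‖ :=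
          norm_sub_le _ _
      _ = 2 * 1 := by rw [norm_direction hp, norm_direction hp]; norm_num
      _ ≤ _ := mul_le_mul (le_max_left _ _) h1 zero_le_one (le_max_of_le_left zero_le_two)
  · refine le_trans ?_ (mul_le_mul_of_nonneg_right (le_max_right _ _) (abs_nonneg _))
    rw [div_mul_eq_mul_div, le_div_iff₀ hs]
    apply le_of_sq_le_sq _ (by positivity)
    have hd := h.dist_le s t
    have h2 := two_mul_cosh_sub_one_le (dist (γ s) (γ t)) 1
      (by rw [abs_of_nonneg dist_nonneg]; linarith)
    rw [cosh_dist_curve hp] at h2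
    have h3 := Real.one_le_cosh (dist p (γ s) - dist p (γ t))
    have h4 : Real.sinh r * Real.sinh r ≤ Real.sinh (dist p (γ s)) * Real.sinh (dist p (γ t)) :=
      mul_le_mul (Real.sinh_le_sinh.2 (hrR s).1) (Real.sinh_le_sinh.2 (hrR t).1) hs.le
        (Real.sinh_nonneg_iff.2 dist_nonneg)
    have h5 := mul_le_mul_of_nonneg_right h4 (sq_nonneg ‖direction p γ s - direction p γ t‖)
    have h6 : Real.cosh 1 ^ 2 * dist (γ s) (γ t) ^ 2 ≤ Real.cosh 1 ^ 2 * |s - t| ^ 2 := by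
      gcongr
    rw [mul_pow, mul_pow]
    nlinarith

/-- The length of the curve of directions in which `p` sees the arc of `γ` from `0` to `s`. -/
noncomputable def visualLength (p : Hyp3) (γ : ℝ → Hyp3) (s : ℝ) : ℝ :=
  variationOnFromTo (direction p γ) Set.univ 0 s

theorem eVariationOn_direction_ne_top {γ : ℝ → Hyp3} {L : ℝ} (h : IsRectifiableClosedCurve γ L)
    {p : Hyp3} (hp : SeesOnce p γ) (s t : ℝ) :
    eVariationOn (direction p γ) (Set.Icc s t) ≠ ⊤ := by
  obtain ⟨C, hC⟩ := exists_lipschitz_direction h hp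
  have := hC.locallyBoundedVariationOn Set.univ s t (Set.mem_univ _) (Set.mem_univ _)
  rwa [Set.univ_inter] at this

theorem visualLength_sub {γ : ℝ → Hyp3} {L : ℝ} (h : IsRectifiableClosedCurve γ L) {p : Hyp3}
    (hp : SeesOnce p γ) {s t : ℝ} (hst : s ≤ t) : visualLength p γ t - visualLength p γ s =
      (eVariationOn (direction p γ) (Set.Icc s t)).toReal := by
  obtain ⟨C, hC⟩ := exists_lipschitz_direction h hp
  have h1 := variationOnFromTo.add (hC.locallyBoundedVariationOn Set.univ)
    (Set.mem_univ 0) (Set.mem_univ s) (Set.mem_univ t)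
  rw [visualLength, visualLength, ← h1, add_sub_cancel_left,
    variationOnFromTo.eq_of_le _ _ hst, Set.univ_inter]

theorem norm_direction_sub_le {γ : ℝ → Hyp3} {L : ℝ} (h : IsRectifiableClosedCurve γ L)
    {p : Hyp3} (hp : SeesOnce p γ) (s t : ℝ) (hst : s ≤ t) :
    ‖direction p γ s - direction p γ t‖ ≤ visualLength p γ t - visualLength p γ s := by
  rw [visualLength_sub h hp hst, ← dist_eq_norm, dist_edist]
  exact ENNReal.toReal_mono (eVariationOn_direction_ne_top h hp s t)
    (eVariationOn.edist_le _ ⟨le_rfl, hst⟩ ⟨hst, le_rfl⟩)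

/-! ### The area of the cone -/

/-- The estimate of `diskArea_le_of_chainSum_le` for a subdivision on which the hyperbolic cosine of
the distance varies by less than `η`. -/
theorem diskArea_le_of_chainSum_le_of_error {γ : ℝ → Hyp3} {L : ℝ}
    (h : IsRectifiableClosedCurve γ L) {p : Hyp3} (hp : SeesOnce p γ) {Θ : ℝ} {X : ℝ → ℝ → ℝ}
    (hX : ∀ S, ChainSum X 0 L S → S ≤ Θ)
    (hloc : ∀ η > 0, ∃ δ > 0, ∀ s t, 0 ≤ s → s ≤ t → t ≤ L → t - s < δ →
      (Real.cosh (dist p (γ s)) - η) * ‖direction p γ s - direction p γ t‖ ≤ X s t)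
    {η : ℝ} (hη : 0 < η) (hη1 : 2 * η ≤ 1) :
    (1 - 2 * η) * (visualLength p γ L - visualLength p γ 0) ≤ Θ ∧
    diskArea (coneDisk p γ L) ≤ ENNReal.ofReal
      (Θ - (1 - 3 * η) * (visualLength p γ L - visualLength p γ 0)) := by
  have hL := h.length_pos
  set P : ℝ → ℝ := fun s => Real.cosh (dist p (γ s)) with hP
  set V := visualLength p γ with hV
  have hVm : Monotone V := fun s t hst => by
    linarith [norm_direction_sub_le h hp s t hst, norm_nonneg (direction p γ s - direction p γ t)]
  have hPc : Continuous P := Real.continuous_cosh.comp (continuous_const.dist h.continuous)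
  obtain ⟨δ, hδ, hδX⟩ := hloc η hη
  obtain ⟨δ', hδ', hδP⟩ := Metric.uniformContinuousOn_iff.1
    (isCompact_Icc.uniformContinuousOn_of_continuous (hPc.continuousOn (s := Set.Icc 0 L))) η hη
  have hlim : Filter.Tendsto (fun n : ℕ => L / (n + 1 : ℕ)) Filter.atTop (nhds 0) := by
    have h0 := (tendsto_one_div_add_atTop_nhds_zero_nat (𝕜 := ℝ)).const_mul L
    rw [mul_zero] at h0
    simpa only [mul_one_div, Nat.cast_add, Nat.cast_one] using h0
  have hev : ∀ᶠ n : ℕ in Filter.atTop, (1 - 2 * η) * (V L - V 0) ≤ Θ ∧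
      ∑ i ∈ Finset.range (n + 1),
        μHE[2] (coneArc p γ (i * (L / (n + 1 : ℕ))) ((i + 1 : ℕ) * (L / (n + 1 : ℕ)))) ≤
      ENNReal.ofReal (Θ - (1 - 3 * η) * (V L - V 0)) := by
    filter_upwards [hlim.eventually_lt_const (lt_min hδ hδ')] with n hn
    have hn1 := hn.trans_le (min_le_left _ _)
    have hn2 := hn.trans_le (min_le_right _ _)
    set d := L / (n + 1 : ℕ) with hd
    have hd0 : 0 < d := by positivity
    have hdL : ((n + 1 : ℕ) : ℝ) * d = L := by rw [hd]; field_simp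
    have hstep : ∀ i : ℕ, ((i + 1 : ℕ) : ℝ) * d = i * d + d := fun i => by push_cast; ring
    have hi0 : ∀ i : ℕ, 0 ≤ (i : ℝ) * d := fun i => by positivity
    have hiL : ∀ i ≤ n + 1, (i : ℝ) * d ≤ L := fun i hi => by
      rw [← hdL]; gcongr
    have hPi : ∀ i < n + 1, ∀ s ∈ Set.Icc ((i : ℝ) * d) ((i + 1 : ℕ) * d),
        |P s - P (i * d)| < η := by
      intro i hi s hs
      have h1 := hδP s ⟨(hi0 i).trans hs.1, hs.2.trans (hiL (i + 1) hi)⟩ (i * d)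
        ⟨hi0 i, hiL i hi.le⟩ (by
          rw [Real.dist_eq, abs_of_nonneg (by linarith [hs.1])]
          have := hs.2
          rw [hstep] at this
          linarith)
      rwa [Real.dist_eq] at h1
    -- On each arc of the subdivision, a chain is chosen whose sum is almost the visual length.
    have hchain : ∀ e > 0, ∀ k ≤ n + 1, ∃ S, ChainSum X 0 (k * d) S ∧
        ∑ i ∈ Finset.range k, (P (i * d) - 2 * η) * (V ((i + 1 : ℕ) * d) - V (i * d)) - k * e ≤
          S := by
      intro e he k
      induction k with
      | zero =>
        intro _
        refine ⟨0, ?_, by simp⟩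
        rw [Nat.cast_zero, zero_mul]
        exact ChainSum.nil
      | succ k ih =>
        intro hk
        obtain ⟨S, hS, hle⟩ := ih (by lia)
        have hkk : (k : ℝ) * d ≤ (k + 1 : ℕ) * d := by rw [hstep]; linarith
        obtain ⟨T, hT, hle'⟩ := exists_chainSum_ge (u := direction p γ) (X := X)
          (c := P (k * d) - 2 * η) hkk (by linarith [Real.one_le_cosh (dist p (γ (k * d)))])
          (by
            intro s t h1 h2 h3
            rw [dist_eq_norm]
            refine le_trans (mul_le_mul_of_nonneg_right ?_ (norm_nonneg _)) (hδX s t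
              ((hi0 k).trans h1) h2 (h3.trans (hiL _ hk)) (by rw [hstep] at h3; linarith))
            have := (abs_lt.1 (hPi k (by lia) s ⟨h1, h2.trans h3⟩)).1
            simp only [hP] at this ⊢
            linarith)
          he
        refine ⟨_, hS.trans hT, ?_⟩
        rw [← visualLength_sub h hp hkk, ← hV] at hle'
        rw [Finset.sum_range_succ]
        have he' : ((k + 1 : ℕ) : ℝ) * e = k * e + e := by push_cast; ring
        linarith
    have hsum : ∑ i ∈ Finset.range (n + 1), (P (i * d) - 2 * η) *
        (V ((i + 1 : ℕ) * d) - V (i * d)) ≤ Θ := by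
      refine le_of_forall_pos_le_add fun e he => ?_
      obtain ⟨S, hS, hle⟩ := hchain (e / (n + 1 : ℕ)) (by positivity) (n + 1) le_rfl
      rw [hdL] at hS
      have := hX S hS
      rw [mul_div_cancel₀ _ (by positivity)] at hle
      linarith
    have htel : ∑ i ∈ Finset.range (n + 1), (V ((i + 1 : ℕ) * d) - V (i * d)) = V L - V 0 := by
      rw [Finset.sum_range_sub (fun i : ℕ => V (i * d)), hdL]
      simp
    have hVi : ∀ i : ℕ, 0 ≤ V ((i + 1 : ℕ) * d) - V (i * d) := fun i =>
      sub_nonneg.2 (hVm (by rw [hstep]; linarith))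
    constructor
    · rw [← htel, Finset.mul_sum]
      refine le_trans (Finset.sum_le_sum fun i _ => ?_) hsum
      exact mul_le_mul_of_nonneg_right
        (by linarith [Real.one_le_cosh (dist p (γ (i * d)))]) (hVi i)
    · have hmeas : ∀ i ∈ Finset.range (n + 1),
          μHE[2] (coneArc p γ (i * d) ((i + 1 : ℕ) * d)) ≤
          ENNReal.ofReal ((P (i * d) + η - 1) * (V ((i + 1 : ℕ) * d) - V (i * d))) := by
        intro i hi
        have hP1 : 1 ≤ P (i * d) + η := by linarith [Real.one_le_cosh (dist p (γ (i * d)))]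
        -- This sector of the cone is within the radius whose hyperbolic cosine is `P (i * d) + η`.
        have hsub := coneArc_subset hp (a := i * d) (b := (i + 1 : ℕ) * d)
          (M := Real.arcosh (P (i * d) + η)) (by
            intro s hs
            have h1 := (abs_lt.1 (hPi i (Finset.mem_range.1 hi) s hs)).2
            rw [← Real.arcosh_cosh (dist_nonneg (x := p) (y := γ s)),
              Real.arcosh_le_arcosh (Real.cosh_pos _) (by linarith)]
            simp only [hP] at h1 ⊢
            linarith)
        refine (measure_mono hsub).trans ?_
        refine (measure_coneShell_le p (Real.arcosh_nonneg hP1) (by rw [hstep]; linarith)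
          (norm_direction hp) (norm_direction_sub_le h hp)).trans (le_of_eq ?_)
        rw [Real.cosh_arcosh hP1]
      refine (Finset.sum_le_sum hmeas).trans ?_
      rw [← ENNReal.ofReal_sum_of_nonneg fun i _ => mul_nonneg
        (by linarith [Real.one_le_cosh (dist p (γ (i * d)))]) (hVi i)]
      apply ENNReal.ofReal_le_ofReal
      have h1 : ∑ i ∈ Finset.range (n + 1), (P (i * d) + η - 1) *
          (V ((i + 1 : ℕ) * d) - V (i * d)) = ∑ i ∈ Finset.range (n + 1), (P (i * d) - 2 * η) *
          (V ((i + 1 : ℕ) * d) - V (i * d)) - (1 - 3 * η) * (V L - V 0) := by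
        rw [← htel, Finset.mul_sum, ← Finset.sum_sub_distrib]
        exact Finset.sum_congr rfl fun i _ => by ring
      rw [h1]
      linarith
  refine ⟨(hev.exists).choose_spec.1, ?_⟩
  refine diskArea_coneDisk_le hL h.periodic h.continuous hp ?_
  filter_upwards [hev] with n hn using hn.2

/-- Suppose that the sums of `X` along chains are at most `Θ`, and that `X s t` is at least
`cosh ρ` times the visual size of short arcs, where `ρ` is the distance to the apex. Then the area
of the cone is at most `Θ` minus the cone angle: the area is the integral of `cosh ρ - 1` with
respect to the visual length. -/
theorem diskArea_le_of_chainSum_le {γ : ℝ → Hyp3} {L : ℝ} (h : IsRectifiableClosedCurve γ L)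
    {p : Hyp3} (hp : SeesOnce p γ) {Θ : ℝ} {X : ℝ → ℝ → ℝ}
    (hX : ∀ S, ChainSum X 0 L S → S ≤ Θ)
    (hloc : ∀ η > 0, ∃ δ > 0, ∀ s t, 0 ≤ s → s ≤ t → t ≤ L → t - s < δ →
      (Real.cosh (dist p (γ s)) - η) * ‖direction p γ s - direction p γ t‖ ≤ X s t) :
    visualLength p γ L - visualLength p γ 0 ≤ Θ ∧ diskArea (coneDisk p γ L) ≤
      ENNReal.ofReal (Θ - (visualLength p γ L - visualLength p γ 0)) := by
  set V := visualLength p γ L - visualLength p γ 0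
  have key : ∀ n : ℕ, (1 - 2 * (1 / 2 * (1 / ((n : ℝ) + 1)))) * V ≤ Θ ∧
      diskArea (coneDisk p γ L) ≤ ENNReal.ofReal
      (Θ - (1 - 3 * (1 / 2 * (1 / ((n : ℝ) + 1)))) * V) := by
    intro n
    refine diskArea_le_of_chainSum_le_of_error h hp hX hloc (by positivity) ?_
    have : 1 / ((n : ℝ) + 1) ≤ 1 := by
      rw [div_le_one (by positivity)]
      linarith [(Nat.cast_nonneg n : (0 : ℝ) ≤ n)]
    linarith
  have h0 := (tendsto_one_div_add_atTop_nhds_zero_nat (𝕜 := ℝ))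
  have hc1 : Continuous fun x : ℝ => (1 - 2 * (1 / 2 * x)) * V := by fun_prop
  have hc2 : Continuous fun x : ℝ => ENNReal.ofReal (Θ - (1 - 3 * (1 / 2 * x)) * V) :=
    ENNReal.continuous_ofReal.comp (by fun_prop)
  have h1 := (hc1.tendsto 0).comp h0
  have h2 := (hc2.tendsto 0).comp h0
  simp only [mul_zero, sub_zero, one_mul] at h1 h2
  exact ⟨le_of_tendsto' h1 fun n => (key n).1, ge_of_tendsto' h2 fun n => (key n).2⟩

/-! ### Geodesic triangles -/

theorem hypAngle_eq_angle (q p r : Hyp3) :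
    hypAngle q p r = InnerProductGeometry.angle (chart p q.pos) (chart p r.pos) := by
  have h : ∀ v w, lorentz (tangentProj p v) (tangentProj p w) =
      inner ℝ (chart p v) (chart p w) := fun v w => by
    rw [lorentz_tangentProj_tangentProj, inner_chart]
  rw [hypAngle, InnerProductGeometry.angle, h, h, h, real_inner_self_eq_norm_sq,
    real_inner_self_eq_norm_sq, Real.sqrt_sq (norm_nonneg _), Real.sqrt_sq (norm_nonneg _)]

theorem hypAngle_comm (q p r : Hyp3) : hypAngle q p r = hypAngle r p q := by
  rw [hypAngle_eq_angle, hypAngle_eq_angle, InnerProductGeometry.angle_comm]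

theorem hypAngle_le_add (q p r x : Hyp3) : hypAngle q p r ≤ hypAngle q p x + hypAngle x p r := by
  simp only [hypAngle_eq_angle]
  exact InnerProductGeometry.angle_le_angle_add_angle _ _ _

theorem cos_hypAngle (q p r : Hyp3) : Real.cos (hypAngle q p r) =
    (Real.cosh (dist p q) * Real.cosh (dist p r) - Real.cosh (dist q r)) /
      (Real.sinh (dist p q) * Real.sinh (dist p r)) := by
  rw [hypAngle_eq_angle, InnerProductGeometry.cos_angle, norm_chart_eq_sinh, norm_chart_eq_sinh,
    inner_chart, cosh_dist, cosh_dist, cosh_dist]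
  ring

/-- Two angles of a hyperbolic triangle in terms of the sides: `P`, `Q` and `C` are the hyperbolic
cosines of the sides and `x`, `y`, `z` the hyperbolic sines; `φ` is the third angle. -/
theorem sin_add_of_law_of_cosines {P Q C x y z a b φ : ℝ} (hx : 0 < x) (hy : 0 < y) (hz : 0 < z)
    (hP : x ^ 2 = P ^ 2 - 1) (hQ : y ^ 2 = Q ^ 2 - 1) (hC : z ^ 2 = C ^ 2 - 1) (hC1 : 0 < C + 1)
    (ha : 0 ≤ Real.sin a) (hb : 0 ≤ Real.sin b) (hφ : 0 ≤ Real.sin φ)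
    (hca : Real.cos a = (P * C - Q) / (x * z)) (hcb : Real.cos b = (Q * C - P) / (y * z))
    (hcφ : Real.cos φ = (P * Q - C) / (x * y)) :
    Real.sin (a + b) = Real.sin φ * ((P + Q) / (C + 1)) := by
  have key : ∀ {x y P Q C a : ℝ}, 0 < x → 0 < y → x ^ 2 = P ^ 2 - 1 → y ^ 2 = Q ^ 2 - 1 →
      0 ≤ Real.sin a → Real.cos a = (P * Q - C) / (x * y) →
      Real.sin a = √(1 + 2 * (P * Q * C) - P ^ 2 - Q ^ 2 - C ^ 2) / (x * y) := by
    intro x y P Q C a hx hy hP hQ ha hca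
    rw [eq_div_iff (mul_pos hx hy).ne'] at hca ⊢
    have h1 : 1 + 2 * (P * Q * C) - P ^ 2 - Q ^ 2 - C ^ 2 = (Real.sin a * (x * y)) ^ 2 := by
      have h2 : (Real.sin a * (x * y)) ^ 2 = x ^ 2 * y ^ 2 - (Real.cos a * (x * y)) ^ 2 := by
        rw [mul_pow, Real.sin_sq]; ring
      rw [h2, hca, hP, hQ]
      ring
    rw [h1, Real.sqrt_sq (by positivity)]
  have h1 := key hx hz hP hC ha hca
  have h2 := key hy hz hQ hC hb hcb
  have h3 := key hx hy hP hQ hφ hcφ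
  rw [show Q * C * P = P * Q * C by ring, show 1 + 2 * (P * Q * C) - Q ^ 2 - C ^ 2 - P ^ 2 =
    1 + 2 * (P * Q * C) - P ^ 2 - Q ^ 2 - C ^ 2 by ring] at h2
  rw [show P * C * Q = P * Q * C by ring, show 1 + 2 * (P * Q * C) - P ^ 2 - C ^ 2 - Q ^ 2 =
    1 + 2 * (P * Q * C) - P ^ 2 - Q ^ 2 - C ^ 2 by ring] at h1
  rw [Real.sin_add, h1, h2, h3, hca, hcb]
  generalize √(1 + 2 * (P * Q * C) - P ^ 2 - Q ^ 2 - C ^ 2) = D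
  have h4 : D / (x * z) * ((Q * C - P) / (y * z)) + (P * C - Q) / (x * z) * (D / (y * z)) =
      D / (x * y) * ((P + Q) * (C - 1) / z ^ 2) := by
    field_simp
    ring
  rw [h4, hC, show (P + Q) * (C - 1) / (C ^ 2 - 1) = (P + Q) / (C + 1) by
    have h5 : C ^ 2 - 1 ≠ 0 := by rw [← hC]; positivity
    rw [div_eq_div_iff h5 hC1.ne']
    ring]

theorem sin_hypAngle_nonneg (q p r : Hyp3) : 0 ≤ Real.sin (hypAngle q p r) := by
  rw [hypAngle_eq_angle]
  exact InnerProductGeometry.sin_angle_nonneg _ _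

/-- The area of the geodesic triangle with vertices `p`, `q`, `q'`, plus its angle at `p`; that is,
`π` minus the two other angles (and zero for `q = q'`). -/
noncomputable def angleComplement (p q q' : Hyp3) : ℝ :=
  open Classical in if q = q' then 0 else Real.pi - hypAngle p q q' - hypAngle p q' q

theorem angleComplement_self (p q : Hyp3) : angleComplement p q q = 0 := by
  simp [angleComplement]

/-- A lower bound of the angle complement: the expression on the left is its sine, by the law of
cosines. -/
theorem sin_hypAngle_mul_le_angleComplement {p q q' : Hyp3} (hq : p ≠ q) (hq' : p ≠ q')
    (hqq' : q ≠ q') : Real.sin (hypAngle q p q') *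
      ((Real.cosh (dist p q) + Real.cosh (dist p q')) / (Real.cosh (dist q q') + 1)) ≤
      angleComplement p q q' := by
  rw [angleComplement, if_neg hqq']
  set a := hypAngle p q q' with ha
  set b := hypAngle p q' q with hb
  have hx : 0 < Real.sinh (dist p q) := Real.sinh_pos_iff.2 (dist_pos.2 hq)
  have hy : 0 < Real.sinh (dist p q') := Real.sinh_pos_iff.2 (dist_pos.2 hq')
  have hz : 0 < Real.sinh (dist q q') := Real.sinh_pos_iff.2 (dist_pos.2 hqq')
  have hca : Real.cos a = (Real.cosh (dist p q) * Real.cosh (dist q q') - Real.cosh (dist p q')) /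
      (Real.sinh (dist p q) * Real.sinh (dist q q')) := by
    rw [ha, cos_hypAngle, dist_comm q p]
  have hcb : Real.cos b = (Real.cosh (dist p q') * Real.cosh (dist q q') - Real.cosh (dist p q)) /
      (Real.sinh (dist p q') * Real.sinh (dist q q')) := by
    rw [hb, cos_hypAngle, dist_comm q' p, dist_comm q' q]
  have hC1 : 0 < Real.cosh (dist q q') + 1 := by linarith [Real.cosh_pos (dist q q')]
  have hsin := sin_add_of_law_of_cosines hx hy hz (Real.sinh_sq _) (Real.sinh_sq _)
    (Real.sinh_sq _) hC1 (sin_hypAngle_nonneg p q q') (sin_hypAngle_nonneg p q' q)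
    (sin_hypAngle_nonneg q p q') hca hcb (cos_hypAngle q p q')
  have hsin0 : 0 ≤ Real.sin (a + b) := by
    rw [hsin]
    exact mul_nonneg (sin_hypAngle_nonneg _ _ _)
      (div_nonneg (add_nonneg (Real.cosh_pos _).le (Real.cosh_pos _).le) hC1.le)
  have hab : a ≤ Real.pi ∧ b ≤ Real.pi := by
    rw [ha, hb, hypAngle_eq_angle, hypAngle_eq_angle]
    exact ⟨InnerProductGeometry.angle_le_pi _ _, InnerProductGeometry.angle_le_pi _ _⟩
  -- The sine of `a + b` is nonnegative, and `a = b = π` is excluded by the sides.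
  have hle : a + b ≤ Real.pi := by
    by_contra! hlt
    rcases hab.1.eq_or_lt with h1 | h1
    · rcases hab.2.eq_or_lt with h2 | h2
      · rw [h1, Real.cos_pi, eq_div_iff (by positivity)] at hca
        rw [h2, Real.cos_pi, eq_div_iff (by positivity)] at hcb
        have hC := Real.one_le_cosh (dist q q')
        nlinarith [Real.cosh_pos (dist p q), Real.cosh_pos (dist p q'), mul_pos hx hz,
          mul_pos hy hz]
      · have := Real.sin_neg_of_neg_of_neg_pi_lt (x := a + b - 2 * Real.pi) (by linarith)
          (by linarith)
        rw [Real.sin_sub_two_pi] at this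
        linarith
    · have := Real.sin_neg_of_neg_of_neg_pi_lt (x := a + b - 2 * Real.pi) (by linarith)
        (by linarith)
      rw [Real.sin_sub_two_pi] at this
      linarith
  rw [← hsin, ← Real.sin_pi_sub]
  have := Real.sin_le (show 0 ≤ Real.pi - (a + b) by linarith)
  linarith

/-- For directions with chord `c`, the sine of the angle is `c * √(1 - c ^ 2 / 4)`. -/
theorem chord_mul_le_sin_hypAngle {p : Hyp3} {γ : ℝ → Hyp3} (hp : SeesOnce p γ) (s t : ℝ) :
    ‖direction p γ s - direction p γ t‖ * (1 - ‖direction p γ s - direction p γ t‖ ^ 2 / 4) ≤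
      Real.sin (hypAngle (γ s) p (γ t)) := by
  set c := ‖direction p γ s - direction p γ t‖ with hc
  have h1 := cosh_dist_curve hp s t
  have hx : 0 < Real.sinh (dist p (γ s)) := Real.sinh_pos_iff.2 (hp.dist_pos s)
  have hy : 0 < Real.sinh (dist p (γ t)) := Real.sinh_pos_iff.2 (hp.dist_pos t)
  have hcos : Real.cos (hypAngle (γ s) p (γ t)) = 1 - c ^ 2 / 2 := by
    rw [cos_hypAngle, h1, Real.cosh_sub]
    field_simp
    ring
  have h2 := Real.sin_sq_add_cos_sq (hypAngle (γ s) p (γ t))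
  rw [hcos] at h2
  apply le_of_sq_le_sq _ (sin_hypAngle_nonneg _ _ _)
  have h3 : 0 ≤ c := norm_nonneg _
  have h4 : c ≤ 2 := (norm_sub_le _ _).trans
    (by rw [norm_direction hp, norm_direction hp]; norm_num)
  have h5 : c ^ 2 ≤ 4 := by nlinarith
  have h6 : (1 - c ^ 2 / 4) ^ 2 ≤ 1 - c ^ 2 / 4 := by nlinarith [sq_nonneg c]
  rw [mul_pow]
  nlinarith [mul_le_mul_of_nonneg_left h6 (sq_nonneg c)]

/-- For short arcs, the angle complement is at least the chord of the directions times the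
hyperbolic cosine of the distance from `p`, up to an arbitrarily small error in the factor. -/
theorem angleComplement_local {γ : ℝ → Hyp3} {L : ℝ} (h : IsRectifiableClosedCurve γ L) {p : Hyp3}
    (hp : SeesOnce p γ) : ∀ η > 0, ∃ δ > 0, ∀ s t, 0 ≤ s → s ≤ t → t ≤ L → t - s < δ →
      (Real.cosh (dist p (γ s)) - η) * ‖direction p γ s - direction p γ t‖ ≤
        angleComplement p (γ s) (γ t) := by
  intro η hη
  obtain ⟨r, R, hr, hrR⟩ := exists_dist_bounds h hp
  obtain ⟨K, hK⟩ := exists_lipschitz_direction h hp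
  set P : ℝ → ℝ := fun s => Real.cosh (dist p (γ s)) with hP
  have hPc : Continuous P := Real.continuous_cosh.comp (continuous_const.dist h.continuous)
  have hPR : ∀ s, P s ≤ Real.cosh R := fun s => Real.cosh_le_cosh.2 (by
    rw [abs_of_nonneg dist_nonneg]
    exact (hrR s).2.trans (le_abs_self R))
  -- For the bound `e` on the variation of `P`, of `cosh` and of half the directions, the factor is
  -- at least `(1 - e) * (2 * P s - e) / (2 + e)`, which is at least `P s - η`.
  set e : ℝ := min 1 (2 * η / (1 + 3 * Real.cosh R)) with he
  have hR := Real.one_le_cosh R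
  have he0 : 0 < e := by positivity
  have he1 : e ≤ 1 := min_le_left _ _
  have heη : e * (1 + 3 * Real.cosh R) ≤ 2 * η := by
    rw [← le_div_iff₀ (by positivity)]
    exact min_le_right _ _
  obtain ⟨δ, hδ, hδP⟩ := Metric.uniformContinuousOn_iff.1
    (isCompact_Icc.uniformContinuousOn_of_continuous (hPc.continuousOn (s := Set.Icc 0 L))) e he0
  obtain ⟨δ', hδ', hδC⟩ := Metric.continuousAt_iff.1 (Real.continuous_cosh.continuousAt (x := 0))
    e he0
  refine ⟨min (min δ δ') (2 * e / (K + 1)), by positivity, fun s t hs hst ht hd => ?_⟩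
  have hd1 : t - s < δ := hd.trans_le ((min_le_left _ _).trans (min_le_left _ _))
  have hd2 : t - s < δ' := hd.trans_le ((min_le_left _ _).trans (min_le_right _ _))
  have hd3 : t - s < 2 * e / (K + 1) := hd.trans_le (min_le_right _ _)
  by_cases heq : γ s = γ t
  · have : direction p γ s = direction p γ t := by simp only [direction, heq]
    rw [this, heq, angleComplement_self, sub_self, norm_zero, mul_zero]
  refine le_trans ?_ (sin_hypAngle_mul_le_angleComplement (hp.ne s) (hp.ne t) heq)
  have hQ := hδP t ⟨hs.trans hst, ht⟩ s ⟨hs, hst.trans ht⟩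
    (by rwa [Real.dist_eq, abs_of_nonneg (by linarith)])
  rw [Real.dist_eq, abs_lt] at hQ
  have hC : Real.cosh (dist (γ s) (γ t)) ≤ 1 + e := by
    have h1 := h.dist_le s t
    rw [abs_sub_comm, abs_of_nonneg (by linarith)] at h1
    have h2 := hδC (x := t - s) (by
      rw [Real.dist_eq, sub_zero, abs_of_nonneg (by linarith)]; exact hd2)
    rw [Real.dist_eq, Real.cosh_zero, abs_lt] at h2
    have h3 : Real.cosh (dist (γ s) (γ t)) ≤ Real.cosh (t - s) := by
      rw [Real.cosh_le_cosh, abs_of_nonneg dist_nonneg, abs_of_nonneg (by linarith)]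
      exact h1
    linarith
  have hsin := chord_mul_le_sin_hypAngle hp s t
  have hc : ‖direction p γ s - direction p γ t‖ ≤ 2 * e := by
    rw [← dist_eq_norm]
    refine (hK.dist_le_mul s t).trans ?_
    rw [Real.dist_eq, abs_sub_comm, abs_of_nonneg (by linarith)]
    rw [lt_div_iff₀ (by positivity)] at hd3
    nlinarith
  have hc2 : ‖direction p γ s - direction p γ t‖ ≤ 2 := (norm_sub_le _ _).trans
    (by rw [norm_direction hp, norm_direction hp]; norm_num)
  have hPs := hPR s
  have hP1 : 1 ≤ P s := Real.one_le_cosh _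
  change (P s - η) * _ ≤ _ * ((P s + P t) / _)
  have hc0 := norm_nonneg (direction p γ s - direction p γ t)
  generalize ‖direction p γ s - direction p γ t‖ = c at hsin hc hc2 hc0 ⊢
  have h1 : (2 * P s - e) / (2 + e) ≤ (P s + P t) / (Real.cosh (dist (γ s) (γ t)) + 1) := by
    apply div_le_div₀ <;> linarith [Real.cosh_pos (dist (γ s) (γ t))]
  have h2 : c * (1 - e) ≤ Real.sin (hypAngle (γ s) p (γ t)) := by
    refine le_trans (mul_le_mul_of_nonneg_left ?_ hc0) hsin
    nlinarith
  have h3 : P s - η ≤ (1 - e) * ((2 * P s - e) / (2 + e)) := by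
    rw [mul_div_assoc', le_div_iff₀ (by linarith)]
    nlinarith [mul_le_mul_of_nonneg_left hPs he0.le, mul_pos he0 hη]
  calc (P s - η) * c ≤ (1 - e) * ((2 * P s - e) / (2 + e)) * c :=
        mul_le_mul_of_nonneg_right h3 hc0
    _ = c * (1 - e) * ((2 * P s - e) / (2 + e)) := by ring
    _ ≤ _ := mul_le_mul h2 h1 (div_nonneg (by linarith) (by linarith))
        (sin_hypAngle_nonneg _ _ _)

/-! ### Inscribed polygons -/

/-- The repeated points of a chain can be dropped. -/
theorem ChainSum.exists_distinct {Y : Type*} {γ : ℝ → Y} {W : Y → Y → ℝ} (hW : ∀ y, W y y = 0)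
    {a b S : ℝ} (h : ChainSum (fun s t => W (γ s) (γ t)) a b S) :
    ∃ (k : ℕ) (t : ℕ → ℝ), t 0 = a ∧ γ (t k) = γ b ∧ t k ≤ b ∧
      (∀ i < k, t i < t (i + 1) ∧ γ (t i) ≠ γ (t (i + 1))) ∧
      S = ∑ i ∈ Finset.range k, W (γ (t i)) (γ (t (i + 1))) := by
  induction h with
  | nil => exact ⟨0, fun _ => a, rfl, rfl, le_rfl, by simp, by simp⟩
  | @step b c S h hbc ih =>
    obtain ⟨k, t, h0, hk, hkb, hlt, hS⟩ := ih
    by_cases hne : γ b = γ c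
    · exact ⟨k, t, h0, hk.trans hne, hkb.trans hbc, hlt, by rw [hne, hW, add_zero, hS]⟩
    · have hbc' : b < c := hbc.lt_of_ne fun h => hne (h ▸ rfl)
      have hv : ∀ i ≤ k, Function.update t (k + 1) c i = t i := fun i hi =>
        Function.update_of_ne (by lia) _ _
      refine ⟨k + 1, Function.update t (k + 1) c, ?_, ?_, ?_, ?_, ?_⟩
      · rw [hv 0 (Nat.zero_le _), h0]
      · rw [Function.update_self]
      · rw [Function.update_self]
      · intro i hi
        rcases (Nat.lt_succ_iff.1 hi).eq_or_lt with rfl | hi'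
        · rw [hv i le_rfl, Function.update_self, hk]
          exact ⟨hkb.trans_lt hbc', hne⟩
        · rw [hv i hi'.le, hv (i + 1) hi']
          exact hlt i hi'
      · rw [Finset.sum_range_succ, hv k le_rfl, Function.update_self, hk, hS]
        congr 1
        refine Finset.sum_congr rfl fun i hi => ?_
        rw [Finset.mem_range] at hi
        rw [hv i hi.le, hv (i + 1) hi]

/-- A closed chain without repetitions is the chain of the vertices of an inscribed polygon. -/
theorem exists_isInscribedPolygon {γ : ℝ → Hyp3} {L : ℝ} (h : IsRectifiableClosedCurve γ L) {k : ℕ}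
    (hk2 : 2 ≤ k) {t : ℕ → ℝ} (h0 : t 0 = 0) (hk : γ (t k) = γ L) (hkL : t k ≤ L)
    (hlt : ∀ i < k, t i < t (i + 1) ∧ γ (t i) ≠ γ (t (i + 1))) :
    ∃ T : ℕ → ℝ, IsInscribedPolygon γ L k T ∧
      ∀ i < k, γ (T i) = γ (t i) ∧ γ (T (i + 1)) = γ (t (i + 1)) := by
  -- The polygon continues the chain quasi-periodically.
  set T : ℕ → ℝ := fun i => t (i % k) + (i / k : ℕ) * L with hT
  have hγ0 : γ (t k) = γ (t 0) := by
    rw [hk, h0]; simpa using h.periodic 0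
  have hmod : ∀ q r : ℕ, r < k → T (k * q + r) = t r + q * L := by
    intro q r hr
    simp only [hT]
    rw [Nat.mul_add_mod, Nat.mod_eq_of_lt hr, Nat.mul_add_div (by lia), Nat.div_eq_of_lt hr,
      add_zero]
  have hγT : ∀ q r : ℕ, r ≤ k → γ (T (k * q + r)) = γ (t r) := by
    intro q r hr
    rcases hr.eq_or_lt with rfl | hr
    · have := hmod (q + 1) 0 (by lia)
      rw [mul_add, mul_one, add_zero] at this
      rw [this, hγ0]
      exact (h.periodic.nat_mul (q + 1)) _
    · rw [hmod q r hr]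
      exact (h.periodic.nat_mul q) _
  have hdecomp : ∀ i : ℕ, ∃ q r, r < k ∧ i = k * q + r := fun i =>
    ⟨i / k, i % k, Nat.mod_lt _ (by lia), (Nat.div_add_mod i k).symm⟩
  refine ⟨T, ⟨hk2, strictMono_nat_of_lt_succ fun i => ?_, fun i => ?_, fun i => ?_⟩, ?_⟩
  · obtain ⟨q, r, hr, rfl⟩ := hdecomp i
    rw [hmod q r hr]
    have h1 := (hlt r hr).1
    rcases (Nat.succ_le_of_lt hr).eq_or_lt with h2 | h2
    · have h3 := hmod (q + 1) 0 (by lia)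
      rw [show k * (q + 1) + 0 = k * q + r + 1 by rw [mul_add]; lia] at h3
      rw [h3, h0]
      have h4 : r + 1 = k := h2
      rw [h4] at h1
      push_cast
      linarith
    · rw [add_assoc, hmod q (r + 1) h2]
      linarith
  · obtain ⟨q, r, hr, rfl⟩ := hdecomp i
    rw [show k * q + r + k = k * (q + 1) + r by ring, hmod _ r hr, hmod _ r hr]
    push_cast
    ring
  · obtain ⟨q, r, hr, rfl⟩ := hdecomp i
    rw [add_assoc, hγT q r hr.le, hγT q (r + 1) hr]
    exact (hlt r hr).2
  · intro i hi
    have h1 := hγT 0 i hi.le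
    have h2 := hγT 0 (i + 1) hi
    rw [mul_zero, zero_add] at h1 h2
    exact ⟨h1, h2⟩

/-- The angle complements of the triangles that join `p` to the edges of a closed polygon add up to
at most the sum of the exterior angles: an angle of the polygon is at most the sum of the adjacent
angles of the two triangles. -/
theorem sum_angleComplement_le {γ : ℝ → Hyp3} {L : ℝ} (h : IsRectifiableClosedCurve γ L)
    {n : ℕ} {T : ℕ → ℝ} (hT : IsInscribedPolygon γ L n T) (p : Hyp3) :
    ∑ i ∈ Finset.range n, angleComplement p (γ (T i)) (γ (T (i + 1))) ≤
      sumExteriorAngles γ n T := by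
  set α : ℕ → ℝ := fun i => hypAngle p (γ (T i)) (γ (T (i + 1))) with hα
  have hper : α n = α 0 := by
    have h1 := hT.periodic 0
    have h2 := hT.periodic 1
    rw [zero_add] at h1
    rw [add_comm 1 n] at h2
    simp only [hα]
    rw [h1, h2, h.periodic, h.periodic]
  have hshift : ∑ i ∈ Finset.range n, α (i + 1) = ∑ i ∈ Finset.range n, α i := by
    have := Finset.sum_range_succ' α n
    rw [Finset.sum_range_succ, hper] at this
    linarith
  calc ∑ i ∈ Finset.range n, angleComplement p (γ (T i)) (γ (T (i + 1)))
      = ∑ i ∈ Finset.range n, (Real.pi - hypAngle (γ (T i)) (γ (T (i + 1))) p) -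
        ∑ i ∈ Finset.range n, α i := by
        rw [← Finset.sum_sub_distrib]
        refine Finset.sum_congr rfl fun i _ => ?_
        rw [angleComplement, if_neg (hT.ne i), hypAngle_comm p (γ (T (i + 1)))]
        ring
    _ = ∑ i ∈ Finset.range n, (Real.pi - hypAngle (γ (T i)) (γ (T (i + 1))) p - α (i + 1)) := by
        rw [← hshift, ← Finset.sum_sub_distrib]
    _ ≤ sumExteriorAngles γ n T := by
        refine Finset.sum_le_sum fun i _ => ?_
        have := hypAngle_le_add (γ (T i)) (γ (T (i + 1))) (γ (T (i + 2))) p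
        simp only [hα]
        rw [show i + 1 + 1 = i + 2 from rfl]
        linarith

/-- After repeated points are dropped, a chain has no step or is an inscribed polygon. -/
theorem ofReal_chainSum_le_totalCurvature {γ : ℝ → Hyp3} {L : ℝ}
    (h : IsRectifiableClosedCurve γ L) (p : Hyp3) {S : ℝ}
    (hS : ChainSum (fun s t => angleComplement p (γ s) (γ t)) 0 L S) :
    ENNReal.ofReal S ≤ totalCurvature γ L := by
  obtain ⟨k, t, h0, hk, hkL, hlt, rfl⟩ := hS.exists_distinct (angleComplement_self p)
  have hγ : γ (t k) = γ (t 0) := by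
    rw [hk, h0]; simpa using h.periodic 0
  match k, hk, hkL, hlt, hγ with
  | 0, _, _, _, _ => simp
  | 1, _, _, hlt, hγ => exact absurd hγ.symm (hlt 0 one_pos).2
  | k + 2, hk, hkL, hlt, _ =>
    obtain ⟨T, hT, hTt⟩ := exists_isInscribedPolygon h (by lia) h0 hk hkL hlt
    refine le_trans (ENNReal.ofReal_le_ofReal ?_) (le_iSup_of_le (k + 2)
      (le_iSup_of_le T (le_iSup_of_le hT le_rfl)))
    refine le_trans (le_of_eq ?_) (sum_angleComplement_le h hT p)
    refine Finset.sum_congr rfl fun i hi => ?_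
    rw [(hTt i (Finset.mem_range.1 hi)).1, (hTt i (Finset.mem_range.1 hi)).2]

/-- The area of a geodesic cone, plus its cone angle, is at most the total curvature. -/
theorem diskArea_coneDisk_add_le_totalCurvature {γ : ℝ → Hyp3} {L : ℝ}
    (h : IsRectifiableClosedCurve γ L) {p : Hyp3} (hp : SeesOnce p γ)
    (hfin : totalCurvature γ L ≠ ⊤) :
    diskArea (coneDisk p γ L) + ENNReal.ofReal (visualLength p γ L - visualLength p γ 0) ≤
      totalCurvature γ L := by
  have hV : 0 ≤ visualLength p γ L - visualLength p γ 0 := (norm_nonneg _).trans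
    (norm_direction_sub_le h hp 0 L h.length_pos.le)
  obtain ⟨h1, h2⟩ := diskArea_le_of_chainSum_le h hp (Θ := (totalCurvature γ L).toReal)
    (X := fun s t => angleComplement p (γ s) (γ t))
    (fun S hS => by
      rw [← ENNReal.ofReal_le_iff_le_toReal hfin]
      exact ofReal_chainSum_le_totalCurvature h p hS)
    (angleComplement_local h hp)
  refine (add_le_add_left h2 _).trans ?_
  rw [← ENNReal.ofReal_add (by linarith) hV, sub_add_cancel, ENNReal.ofReal_toReal hfin]

/-- The area of a cone is finite, even if the total curvature is not: it is bounded by the length of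
the curve of directions. -/
theorem diskArea_coneDisk_lt_top {γ : ℝ → Hyp3} {L : ℝ} (h : IsRectifiableClosedCurve γ L)
    {p : Hyp3} (hp : SeesOnce p γ) : diskArea (coneDisk p γ L) < ⊤ := by
  obtain ⟨r, R, _, hrR⟩ := exists_dist_bounds h hp
  refine (diskArea_le_of_chainSum_le h hp
    (X := fun s t => Real.cosh R * visualLength p γ t - Real.cosh R * visualLength p γ s)
    (fun S hS => (hS.eq_sub fun _ _ _ => rfl).le) ?_).2.trans_lt ENNReal.ofReal_lt_top
  refine fun η hη => ⟨1, one_pos, fun s t _ hst _ _ => ?_⟩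
  rw [← mul_sub]
  refine mul_le_mul ?_ (norm_direction_sub_le h hp s t hst) (norm_nonneg _) (Real.cosh_pos R).le
  have : Real.cosh (dist p (γ s)) ≤ Real.cosh R := Real.cosh_le_cosh.2 (by
    rw [abs_of_nonneg dist_nonneg]
    exact (hrR s).2.trans (le_abs_self R))
  linarith

/-! ### The cone angle -/

theorem norm_sub_eq_two_mul_sin {E : Type*} [NormedAddCommGroup E] [InnerProductSpace ℝ E]
    {x y : E} (hx : ‖x‖ = 1) (hy : ‖y‖ = 1) :
    ‖x - y‖ = 2 * Real.sin (InnerProductGeometry.angle x y / 2) := by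
  have h0 : 0 ≤ Real.sin (InnerProductGeometry.angle x y / 2) := by
    apply Real.sin_nonneg_of_nonneg_of_le_pi <;>
    linarith [InnerProductGeometry.angle_nonneg x y, InnerProductGeometry.angle_le_pi x y]
  rw [← sq_eq_sq₀ (norm_nonneg _) (by positivity), @norm_sub_sq_real, hx, hy,
    ← InnerProductGeometry.cos_angle_mul_norm_mul_norm, hx, hy]
  have h1 := Real.cos_sq (InnerProductGeometry.angle x y / 2)
  rw [mul_div_cancel₀ _ two_ne_zero] at h1
  rw [mul_pow, Real.sin_sq, h1]
  ring

/-- The angle of two unit vectors with a small chord is almost at most the chord. -/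
theorem exists_angle_le_chord {E : Type*} [NormedAddCommGroup E] [InnerProductSpace ℝ E] {η : ℝ}
    (hη : 0 < η) : ∃ δ > 0, ∀ x y : E, ‖x‖ = 1 → ‖y‖ = 1 → ‖x - y‖ < δ →
      (1 - η) * InnerProductGeometry.angle x y ≤ ‖x - y‖ := by
  refine ⟨min 1 η / 2, by positivity, fun x y hx hy hxy => ?_⟩
  rw [norm_sub_eq_two_mul_sin hx hy] at hxy ⊢
  set φ := InnerProductGeometry.angle x y with hφ
  have h0 : 0 ≤ φ := InnerProductGeometry.angle_nonneg x y
  have h1 := Real.mul_le_sin (x := φ / 2) (by positivity)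
    (by linarith [InnerProductGeometry.angle_le_pi x y])
  have h2 : φ / 2 ≤ min 1 η := by
    have h3 : 2 / Real.pi * (φ / 2) ≤ min 1 η / 4 := by linarith
    have h4 : φ / 2 = Real.pi / 2 * (2 / Real.pi * (φ / 2)) := by
      have := Real.pi_pos
      field_simp
    rw [h4]
    have h5 : 0 < min 1 η := by positivity
    nlinarith [Real.pi_le_four, Real.pi_pos]
  rcases h0.eq_or_lt with h0 | h0
  · rw [← h0]; simp
  have h3 := (Real.sin_gt_sub_cube (x := φ / 2) (by positivity)).le
  have h4 : φ / 2 ≤ η := h2.trans (min_le_right _ _)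
  have h5 : φ / 2 ≤ 1 := h2.trans (min_le_left _ _)
  have h6 : (φ / 2) ^ 3 ≤ η * (φ / 2) := by
    have : (φ / 2) ^ 2 ≤ η := by nlinarith
    nlinarith
  nlinarith

theorem hypAngle_eq_angle_direction {p : Hyp3} {γ : ℝ → Hyp3} (hp : SeesOnce p γ) (s t : ℝ) :
    hypAngle (γ s) p (γ t) = InnerProductGeometry.angle (direction p γ s) (direction p γ t) := by
  rw [hypAngle_eq_angle, direction, direction,
    InnerProductGeometry.angle_smul_left_of_pos _ _
      (inv_pos.2 (norm_pos_iff.2 (hp.chart_ne_zero s))),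
    InnerProductGeometry.angle_smul_right_of_pos _ _
      (inv_pos.2 (norm_pos_iff.2 (hp.chart_ne_zero t)))]

/-- A curve on the unit sphere is at least as long as the angle between its endpoints. -/
theorem hypAngle_le_visualLength {γ : ℝ → Hyp3} {L : ℝ} (h : IsRectifiableClosedCurve γ L)
    {p : Hyp3} (hp : SeesOnce p γ) {s t : ℝ} (hst : s ≤ t) :
    hypAngle (γ s) p (γ t) ≤ visualLength p γ t - visualLength p γ s := by
  rw [hypAngle_eq_angle_direction hp]
  set u := direction p γ with hu
  set V := visualLength p γ with hV
  obtain ⟨K, hK⟩ := exists_lipschitz_direction h hp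
  have key : ∀ η > 0, (1 - η) * InnerProductGeometry.angle (u s) (u t) ≤ V t - V s := by
    intro η hη
    rcases le_or_gt 1 η with h1 | h1
    · refine le_trans ?_ ((norm_nonneg _).trans (norm_direction_sub_le h hp s t hst))
      exact mul_nonpos_of_nonpos_of_nonneg (by linarith) (InnerProductGeometry.angle_nonneg _ _)
    obtain ⟨δ, hδ, hδu⟩ := exists_angle_le_chord (E := EuclideanSpace ℝ (Fin 3)) hη
    obtain ⟨n, hn⟩ := exists_nat_gt (K * (t - s) / δ)
    have hn0 : (0 : ℝ) < n := lt_of_le_of_lt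
      (div_nonneg (mul_nonneg K.2 (by linarith)) hδ.le) hn
    set d := (t - s) / n with hd
    have hd0 : 0 ≤ d := div_nonneg (by linarith) hn0.le
    have hdK : K * d < δ := by
      rw [hd, mul_div_assoc', div_lt_iff₀ hn0]
      rw [div_lt_iff₀ hδ] at hn
      linarith
    have hstep : ∀ k : ℕ,
        (1 - η) * InnerProductGeometry.angle (u s) (u (s + k * d)) ≤ V (s + k * d) - V s := by
      intro k
      induction k with
      | zero =>
        have hus : u s ≠ 0 := by
          rw [← norm_pos_iff, hu, norm_direction hp]; exact one_pos
        simp [InnerProductGeometry.angle_self hus]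
      | succ k ih =>
        have e : s + (k + 1 : ℕ) * d = s + k * d + d := by push_cast; ring
        rw [e]
        have h2 := InnerProductGeometry.angle_le_angle_add_angle (u s) (u (s + k * d))
          (u (s + k * d + d))
        have h3 : ‖u (s + k * d) - u (s + k * d + d)‖ < δ := by
          rw [← dist_eq_norm]
          refine (hK.dist_le_mul _ _).trans_lt ?_
          rw [Real.dist_eq, sub_add_cancel_left, abs_neg, abs_of_nonneg hd0]
          exact hdK
        have h4 := hδu _ _ (norm_direction hp _) (norm_direction hp _) h3
        have h5 := norm_direction_sub_le h hp (s + k * d) (s + k * d + d) (by linarith)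
        have h6 := mul_le_mul_of_nonneg_left h2 (show 0 ≤ 1 - η by linarith)
        rw [mul_add] at h6
        linarith
    have := hstep n
    rwa [hd, mul_div_cancel₀ _ hn0.ne', add_sub_cancel] at this
  have hc : Continuous fun η : ℝ => (1 - η) * InnerProductGeometry.angle (u s) (u t) := by fun_prop
  have h1 : Filter.Tendsto (fun η : ℝ => (1 - η) * InnerProductGeometry.angle (u s) (u t))
      (nhdsWithin 0 (Set.Ioi 0)) (nhds ((1 - 0) * InnerProductGeometry.angle (u s) (u t))) :=
    (hc.tendsto 0).mono_left nhdsWithin_le_nhds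
  rw [sub_zero, one_mul] at h1
  exact le_of_tendsto h1 (Filter.eventually_of_mem self_mem_nhdsWithin fun η hη => key η hη)

/-- Both arcs of the curve between two of its points are seen at least under the angle of the
points. -/
theorem two_mul_hypAngle_le {γ : ℝ → Hyp3} {L : ℝ} (h : IsRectifiableClosedCurve γ L)
    {p : Hyp3} (hp : SeesOnce p γ) {s : ℝ} (hs : s ∈ Set.Icc 0 L) :
    2 * hypAngle (γ 0) p (γ s) ≤ visualLength p γ L - visualLength p γ 0 := by
  have h1 := hypAngle_le_visualLength h hp hs.1
  have h2 := hypAngle_le_visualLength h hp hs.2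
  have h3 : γ L = γ 0 := by simpa using h.periodic 0
  rw [h3, hypAngle_comm] at h2
  linarith

/-! ### The choice of the apex -/

/-- The central projection of the open future cone to the hyperboloid (with a junk value, the given
point, elsewhere). -/
noncomputable def projHyp (o : Hyp3) (v : Minkowski) : Hyp3 :=
  open Classical in
  if h : lorentz v v < 0 ∧ 0 < v.1 then
    { pos := (√(-lorentz v v))⁻¹ • v
      lorentz_self := by
        have h1 : 0 < -lorentz v v := by linarith [h.1]
        have h2 := Real.sq_sqrt h1.le
        have h3 : 0 < √(-lorentz v v) := Real.sqrt_pos.2 h1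
        rw [lorentz_smul_left, lorentz_smul_right]
        field_simp
        linarith
      time_pos := by
        have h1 : 0 < -lorentz v v := by linarith [h.1]
        exact mul_pos (inv_pos.2 (Real.sqrt_pos.2 h1)) h.2 }
  else o

theorem projHyp_pos (o : Hyp3) {v : Minkowski} (h : lorentz v v < 0 ∧ 0 < v.1) :
    (projHyp o v).pos = (√(-lorentz v v))⁻¹ • v := by
  rw [projHyp, dif_pos h]

theorem eq_smul_projHyp (o : Hyp3) {v : Minkowski} (h : lorentz v v < 0 ∧ 0 < v.1) :
    v = √(-lorentz v v) • (projHyp o v).pos := by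
  rw [projHyp_pos o h, smul_inv_smul₀ (Real.sqrt_pos.2 (by linarith [h.1])).ne']

theorem isOpen_futureCone : IsOpen {v : Minkowski | lorentz v v < 0 ∧ 0 < v.1} :=
  (isOpen_lt (continuous_id.lorentz continuous_id) continuous_const).inter
    (isOpen_lt continuous_const continuous_fst)

theorem continuousAt_projHyp (o : Hyp3) {v : Minkowski} (h : lorentz v v < 0 ∧ 0 < v.1) :
    ContinuousAt (projHyp o) v := by
  apply continuousAt_hyp3
  have h1 : ContinuousAt (fun w : Minkowski => (√(-lorentz w w))⁻¹ • w) v := by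
    have h2 : ContinuousAt (fun w : Minkowski => √(-lorentz w w)) v :=
      (Real.continuous_sqrt.comp (continuous_id.lorentz continuous_id).neg).continuousAt
    exact (h2.inv₀ (Real.sqrt_pos.2 (by linarith [h.1])).ne').smul continuousAt_id
  refine h1.congr ?_
  filter_upwards [isOpen_futureCone.mem_nhds h] with w hw
  exact (projHyp_pos o hw).symm

theorem combo_mem_futureCone (x y : Hyp3) {a b : ℝ} (ha : 0 ≤ a) (hb : 0 ≤ b) (hab : 0 < a + b) :
    lorentz (a • x.pos + b • y.pos) (a • x.pos + b • y.pos) < 0 ∧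
      0 < (a • x.pos + b • y.pos).1 := by
  have hx := x.time_pos
  have hy := y.time_pos
  constructor
  · simp only [lorentz_add_left, lorentz_add_right, lorentz_smul_left, lorentz_smul_right,
      x.lorentz_self, y.lorentz_self, lorentz_comm y.pos x.pos]
    have := one_le_neg_lorentz x y
    nlinarith [mul_nonneg ha hb, sq_pos_of_pos hab]
  · simp only [Prod.fst_add, Prod.smul_fst, smul_eq_mul]
    rcases ha.eq_or_lt with rfl | ha
    · have : 0 < b := by linarith
      nlinarith
    · nlinarith [mul_pos ha hx, mul_nonneg hb hy.le]

/-- The cone in Minkowski space over a subset of the hyperboloid. -/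
def coneOver (K : Set Hyp3) : Set Minkowski :=
  {v | ∃ a : ℝ, 0 ≤ a ∧ ∃ x ∈ K, v = a • x.pos}

theorem smul_mem_coneOver {K : Set Hyp3} {v : Minkowski} (hv : v ∈ coneOver K) {c : ℝ}
    (hc : 0 ≤ c) : c • v ∈ coneOver K := by
  obtain ⟨a, ha, x, hx, rfl⟩ := hv
  exact ⟨c * a, mul_nonneg hc ha, x, hx, by rw [mul_smul]⟩

theorem pos_mem_coneOver_iff {K : Set Hyp3} {x : Hyp3} : x.pos ∈ coneOver K ↔ x ∈ K := by
  constructor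
  · rintro ⟨a, ha, y, hy, h⟩
    have h1 := x.lorentz_self
    rw [h, lorentz_smul_left, lorentz_smul_right, y.lorentz_self] at h1
    have h2 : a = 1 := by nlinarith
    rw [h2, one_smul] at h
    rwa [Hyp3.ext h]
  · exact fun h => ⟨1, zero_le_one, x, h, by rw [one_smul]⟩

theorem convex_coneOver {K : Set Hyp3} (hK : GeodesicallyConvex K) : Convex ℝ (coneOver K) := by
  rintro _ ⟨a, ha, x, hx, rfl⟩ _ ⟨b, hb, y, hy, rfl⟩ s t hs ht _
  rw [smul_smul, smul_smul]
  have hsa := mul_nonneg hs ha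
  have htb := mul_nonneg ht hb
  rcases (add_nonneg hsa htb).eq_or_lt with h | h
  · have h1 : s * a = 0 := by linarith
    have h2 : t * b = 0 := by linarith
    exact ⟨0, le_rfl, x, hx, by rw [h1, h2]; simp⟩
  · have hv := combo_mem_futureCone x y hsa htb h
    refine ⟨_, Real.sqrt_nonneg _, projHyp x _, ?_, eq_smul_projHyp x hv⟩
    have h0 := inv_nonneg.2 (Real.sqrt_nonneg (-lorentz ((s * a) • x.pos + (t * b) • y.pos)
      ((s * a) • x.pos + (t * b) • y.pos)))
    refine hK x hx y hy _ _ _ (mul_nonneg h0 hsa) (mul_nonneg h0 htb) ?_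
    rw [projHyp_pos x hv, smul_add, smul_smul, smul_smul]

theorem smul_mem_interior_coneOver {K : Set Hyp3} {v : Minkowski}
    (hv : v ∈ interior (coneOver K)) {c : ℝ} (hc : 0 < c) : c • v ∈ interior (coneOver K) := by
  rw [mem_interior_iff_mem_nhds] at hv ⊢
  have h1 : Continuous fun w : Minkowski => c⁻¹ • w := continuous_const_smul _
  have h2 := h1.continuousAt (x := c • v)
  unfold ContinuousAt at h2
  simp only [inv_smul_smul₀ hc.ne'] at h2
  filter_upwards [h2 hv] with w hw
  have := smul_mem_coneOver hw hc.le
  rwa [smul_inv_smul₀ hc.ne'] at this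

theorem mem_interior_of_pos_mem {K : Set Hyp3} {x : Hyp3} (h : x.pos ∈ interior (coneOver K)) :
    x ∈ interior K := by
  rw [mem_interior]
  exact ⟨Hyp3.pos ⁻¹' interior (coneOver K),
    fun y hy => pos_mem_coneOver_iff.1 (interior_subset hy),
    isOpen_interior.preimage continuous_pos, h⟩

theorem pos_mem_closure_coneOver {K : Set Hyp3} {x : Hyp3} (h : x ∈ closure K) :
    x.pos ∈ closure (coneOver K) :=
  map_mem_closure continuous_pos h fun _ hy => pos_mem_coneOver_iff.2 hy

/-- A curve in the boundary of a convex set is seen once from points near to the midpoint of any of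
its chords. If the convex set has interior points, one takes them; otherwise it lies in a totally
geodesic plane, and one takes points off the plane. Both cases are treated in Minkowski space, for
the convex cone over the set. -/
theorem exists_seesOnce {K : Set Hyp3} (hK : GeodesicallyConvex K) {γ : ℝ → Hyp3}
    (hγK : ∀ s, γ s ∈ frontier K) (s t : ℝ) {U : Set Hyp3}
    (hU : U ∈ nhds (projHyp (γ 0) ((1 / 2 : ℝ) • (γ s).pos + (1 / 2 : ℝ) • (γ t).pos))) :
    ∃ p ∈ U, SeesOnce p γ := by
  set v : Minkowski := (1 / 2 : ℝ) • (γ s).pos + (1 / 2 : ℝ) • (γ t).pos with hv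
  set C := coneOver K with hC
  have hvΩ := combo_mem_futureCone (γ s) (γ t) (a := 1 / 2) (b := 1 / 2) (by norm_num)
    (by norm_num) (by norm_num)
  rw [← hv] at hvΩ
  have hW : ∀ᶠ w in nhds v, projHyp (γ 0) w ∈ U ∧ lorentz w w < 0 ∧ 0 < w.1 :=
    ((continuousAt_projHyp (γ 0) hvΩ).eventually hU).and
      (isOpen_futureCone.mem_nhds hvΩ)
  have hγC : ∀ s, (γ s).pos ∈ closure C := fun s =>
    pos_mem_closure_coneOver (frontier_subset_closure (hγK s))
  have hconv := convex_coneOver hK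
  rw [← hC] at hconv
  have hvC : v ∈ closure C := hconv.closure (hγC s) (hγC t) (by norm_num) (by norm_num)
    (by norm_num)
  by_cases hne : (interior C).Nonempty
  · rw [← hconv.closure_interior_eq_closure_of_nonempty_interior hne] at hvC
    obtain ⟨w, ⟨hwU, hwΩ⟩, hwC⟩ := mem_closure_iff_nhds.1 hvC _ hW
    refine ⟨_, hwU, ?_⟩
    set p := projHyp (γ 0) w with hp
    have hpC : p.pos ∈ interior C := by
      rw [hp, projHyp_pos _ hwΩ]
      exact smul_mem_interior_coneOver hwC
        (inv_pos.2 (Real.sqrt_pos.2 (by linarith [hwΩ.1])))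
    -- A combination with a positive coefficient of `p` would be in the interior.
    intro s t a b ha hb h
    by_contra hne0
    have ha0 : 0 < a := ha.lt_of_ne (Ne.symm hne0)
    have h1 := hconv.combo_interior_closure_mem_interior hpC (hγC s) (a := a / (a + b))
      (b := b / (a + b)) (by positivity) (by positivity) (by field_simp)
    have h2 := smul_mem_interior_coneOver h1 (c := a + b) (by positivity)
    rw [smul_add, smul_smul, smul_smul, mul_div_cancel₀ _ (by positivity),
      mul_div_cancel₀ _ (by positivity), ← h] at h2
    exact (hγK t).2 (mem_interior_of_pos_mem h2)
  · have hK0 : K.Nonempty := closure_nonempty_iff.1 ⟨γ 0, frontier_subset_closure (hγK 0)⟩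
    obtain ⟨x0, hx0⟩ := hK0
    have h0 : (0 : Minkowski) ∈ C := ⟨0, le_rfl, x0, hx0, by simp⟩
    rw [hconv.interior_nonempty_iff_affineSpan_eq_top] at hne
    have hspan : Submodule.span ℝ C < ⊤ := by
      rw [lt_top_iff_ne_top]
      intro h
      apply hne
      apply SetLike.coe_injective
      rw [← Set.insert_eq_of_mem h0, affineSpan_insert_zero, h]
      rfl
    obtain ⟨l, hl0, hl⟩ := Submodule.exists_le_ker_of_lt_top _ hspan
    have hlc : Continuous l := l.continuous_of_finiteDimensional
    have hlC : ∀ w ∈ closure C, l w = 0 := by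
      intro w hw
      have hcl : IsClosed {w | l w = 0} := isClosed_eq hlc continuous_const
      exact closure_minimal (fun w hw => hl (Submodule.subset_span hw)) hcl hw
    obtain ⟨w0, hw0⟩ : ∃ w0, l w0 ≠ 0 := by
      by_contra! hcon
      exact hl0 (LinearMap.ext hcon)
    have hc : Filter.Tendsto (fun e : ℝ => v + e • w0) (nhdsWithin 0 {0}ᶜ) (nhds v) := by
      have h1 : Continuous fun e : ℝ => v + e • w0 := by fun_prop
      have h2 := (h1.tendsto 0).mono_left (nhdsWithin_le_nhds (s := {0}ᶜ))
      simpa using h2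
    obtain ⟨e, ⟨heU, heΩ⟩, he⟩ := ((hc.eventually hW).and self_mem_nhdsWithin).exists
    refine ⟨_, heU, ?_⟩
    set p := projHyp (γ 0) (v + e • w0) with hp
    have hlp : l p.pos ≠ 0 := by
      rw [hp, projHyp_pos _ heΩ, map_smul, map_add, hlC v hvC, zero_add, map_smul]
      exact smul_ne_zero (inv_pos.2 (Real.sqrt_pos.2 (by linarith [heΩ.1]))).ne'
        (smul_ne_zero he hw0)
    -- The linear form `l` vanishes on the curve, but not at `p`.
    intro s t a b _ _ h
    have h1 := congrArg l h
    rw [map_add, map_smul, map_smul, hlC _ (hγC s), hlC _ (hγC t), smul_zero, add_zero] at h1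
    exact (smul_eq_zero.1 h1.symm).resolve_right hlp

/-- The endpoints of a geodesic segment are seen at angles close to `π` from points close to its
midpoint. -/
theorem tendsto_hypAngle_midpoint (o q q' : Hyp3) (hqq' : q ≠ q') :
    Filter.Tendsto (fun p => hypAngle q p q')
      (nhds (projHyp o ((1 / 2 : ℝ) • q.pos + (1 / 2 : ℝ) • q'.pos))) (nhds Real.pi) := by
  set m := projHyp o ((1 / 2 : ℝ) • q.pos + (1 / 2 : ℝ) • q'.pos) with hm
  have hΩ := combo_mem_futureCone q q' (a := 1 / 2) (b := 1 / 2) (by norm_num)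
    (by norm_num) (by norm_num)
  obtain ⟨c, hc⟩ : ∃ c : ℝ, m.pos = c • (q.pos + q'.pos) :=
    ⟨_, by rw [hm, projHyp_pos o hΩ, ← smul_add, smul_smul]⟩
  set C := Real.cosh (dist q q') with hC
  have hCl : lorentz q.pos q'.pos = -C := by rw [hC, cosh_dist, neg_neg]
  have h1 : c ^ 2 * (2 + 2 * C) = 1 := by
    have h := m.lorentz_self
    rw [hc] at h
    simp only [lorentz_add_left, lorentz_add_right, lorentz_smul_left, lorentz_smul_right,
      q.lorentz_self, q'.lorentz_self, lorentz_comm q'.pos q.pos, hCl] at h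
    linarith
  have hq : Real.cosh (dist m q) = c * (1 + C) := by
    rw [cosh_dist, hc, lorentz_smul_left, lorentz_add_left, q.lorentz_self, lorentz_comm q'.pos,
      hCl]
    ring
  have hq' : Real.cosh (dist m q') = c * (1 + C) := by
    rw [cosh_dist, hc, lorentz_smul_left, lorentz_add_left, q'.lorentz_self, hCl]
    ring
  have hdist : dist m q = dist m q' := by
    rw [hyp3_dist_eq, hyp3_dist_eq, ← cosh_dist, ← cosh_dist, hq, hq']
  have hC1 : 1 < C := by
    rw [hC, Real.one_lt_cosh]
    exact dist_ne_zero.2 hqq'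
  have hP : Real.cosh (dist m q) ^ 2 = (1 + C) / 2 := by
    rw [hq, mul_pow]
    nlinarith
  have hS : Real.sinh (dist m q) ^ 2 = (C - 1) / 2 := by
    rw [Real.sinh_sq, hP]; ring
  have hS0 : Real.sinh (dist m q) ≠ 0 := by
    intro h
    rw [h] at hS
    linarith
  have hval : (Real.cosh (dist m q) * Real.cosh (dist m q') - Real.cosh (dist q q')) /
      (Real.sinh (dist m q) * Real.sinh (dist m q')) = -1 := by
    rw [← hdist, ← pow_two, ← pow_two, hS, hP, ← hC, div_eq_iff (by linarith)]
    ring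
  have hcont : ContinuousAt (fun p : Hyp3 => Real.arccos
      ((Real.cosh (dist p q) * Real.cosh (dist p q') - Real.cosh (dist q q')) /
      (Real.sinh (dist p q) * Real.sinh (dist p q')))) m := by
    refine Real.continuous_arccos.continuousAt.comp (ContinuousAt.div ?_ ?_ ?_)
    · fun_prop
    · fun_prop
    · rw [← hdist]
      exact mul_ne_zero hS0 hS0
  unfold ContinuousAt at hcont
  simp only [hval, Real.arccos_neg_one] at hcont
  refine hcont.congr fun p => ?_
  rw [← cos_hypAngle, hypAngle_eq_angle, Real.arccos_cos (InnerProductGeometry.angle_nonneg _ _)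
    (InnerProductGeometry.angle_le_pi _ _)]

theorem IsRectifiableClosedCurve.exists_ne {γ : ℝ → Hyp3} {L : ℝ}
    (h : IsRectifiableClosedCurve γ L) : ∃ s ∈ Set.Icc 0 L, γ 0 ≠ γ s := by
  by_contra! hcon
  have h1 := h.unitSpeed (Set.mem_univ 0) (Set.mem_univ L)
  rw [eVariationOn.constant_on, eq_comm, ENNReal.ofReal_eq_zero] at h1
  · have := h.length_pos
    simp at h1
    linarith
  · rintro _ ⟨s, ⟨_, hs⟩, rfl⟩ _ ⟨t, ⟨_, ht⟩, rfl⟩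
    rw [← hcon s hs, ← hcon t ht]

/-- There are apexes from which the curve is seen once and under a cone angle of almost `2 π`:
points close to the midpoint of a chord of the curve. -/
theorem exists_apex {K : Set Hyp3} (hK : GeodesicallyConvex K) {γ : ℝ → Hyp3} {L : ℝ}
    (h : IsRectifiableClosedCurve γ L) (hγK : ∀ s, γ s ∈ frontier K) {ε : ℝ} (hε : 0 < ε) :
    ∃ p, SeesOnce p γ ∧ 2 * Real.pi - ε < visualLength p γ L - visualLength p γ 0 := by
  obtain ⟨s, hs, hne⟩ := h.exists_ne
  have h1 := (tendsto_hypAngle_midpoint (γ 0) (γ 0) (γ s) hne).eventually_const_lt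
    (show Real.pi - ε / 2 < Real.pi by linarith)
  obtain ⟨p, hpU, hp⟩ := exists_seesOnce hK hγK 0 s h1
  refine ⟨p, hp, ?_⟩
  have h2 := two_mul_hypAngle_le h hp hs
  have h3 : Real.pi - ε / 2 < hypAngle (γ 0) p (γ s) := hpU
  linarith

/-! ### Curves of class `C²` -/

theorem HasDerivAt.lorentz {f g : ℝ → Minkowski} {f' g' : Minkowski} {s : ℝ}
    (hf : HasDerivAt f f' s) (hg : HasDerivAt g g' s) :
    HasDerivAt (fun s => lorentz (f s) (g s)) (lorentz f' (g s) + lorentz (f s) g') s := by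
  have e1 : ∀ {f : ℝ → Minkowski} {f' : Minkowski}, HasDerivAt f f' s →
      HasDerivAt (fun s => (f s).1) f'.1 s := fun hf =>
    (ContinuousLinearMap.fst ℝ ℝ (EuclideanSpace ℝ (Fin 3))).hasFDerivAt.comp_hasDerivAt s hf
  have e2 : ∀ {f : ℝ → Minkowski} {f' : Minkowski}, HasDerivAt f f' s →
      HasDerivAt (fun s => (f s).2) f'.2 s := fun hf =>
    (ContinuousLinearMap.snd ℝ ℝ (EuclideanSpace ℝ (Fin 3))).hasFDerivAt.comp_hasDerivAt s hf
  have h1 := (e1 hf).mul (e1 hg)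
  have h2 := (e2 hf).inner ℝ (e2 hg)
  refine (h2.sub h1).congr_deriv ?_
  simp only [_root_.lorentz]
  ring

theorem lorentz_sub_pos (p q : Hyp3) :
    lorentz (p.pos - q.pos) (p.pos - q.pos) = 2 * (Real.cosh (dist p q) - 1) := by
  rw [sub_eq_add_neg, ← neg_one_smul ℝ q.pos]
  simp only [lorentz_add_left, lorentz_add_right, lorentz_smul_left, lorentz_smul_right,
    p.lorentz_self, q.lorentz_self, lorentz_comm q.pos p.pos, cosh_dist]
  ring

theorem lorentz_smul_smul (a : ℝ) (v : Minkowski) :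
    lorentz (a • v) (a • v) = a ^ 2 * lorentz v v := by
  rw [lorentz_smul_left, lorentz_smul_right]; ring

theorem lorentz_deriv_le_one {γ : ℝ → Hyp3} {L : ℝ} (h : IsRectifiableClosedCurve γ L) {s : ℝ}
    {v : Minkowski} (hv : HasDerivAt (fun s => (γ s).pos) v s) : lorentz v v ≤ 1 := by
  have h1 := hv.tendsto_slope
  have h2 : Filter.Tendsto (fun w : Minkowski => lorentz w w) (nhds v) (nhds (lorentz v v)) :=
    (continuous_id.lorentz continuous_id).tendsto v
  have h3 := h2.comp h1
  have h4 : Filter.Tendsto (fun t : ℝ => Real.cosh |t - s| ^ 2) (nhdsWithin s {s}ᶜ) (nhds 1) := by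
    have h5 : Continuous fun t : ℝ => Real.cosh |t - s| ^ 2 := by fun_prop
    have h6 := (h5.tendsto s).mono_left (nhdsWithin_le_nhds (s := {s}ᶜ))
    simpa using h6
  refine le_of_tendsto_of_tendsto h3 h4 (Filter.eventually_of_mem self_mem_nhdsWithin ?_)
  intro t ht
  have hts : t - s ≠ 0 := sub_ne_zero.2 ht
  simp only [Function.comp_def, slope, vsub_eq_sub]
  rw [lorentz_smul_smul, lorentz_sub_pos, inv_pow, inv_mul_le_iff₀ (by positivity)]
  have h5 : dist (γ t) (γ s) ≤ |t - s| := h.dist_le t s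
  have h6 : Real.cosh (dist (γ t) (γ s)) ≤ Real.cosh (t - s) := by
    rw [Real.cosh_le_cosh, abs_of_nonneg dist_nonneg]
    exact h5
  have h7 := two_mul_cosh_sub_one_le (t - s) |t - s| le_rfl
  linarith

/-- A curve parametrized by arc length has unit velocity, where it has a strict derivative. -/
theorem lorentz_deriv_eq_one {γ : ℝ → Hyp3} {L : ℝ} (h : IsRectifiableClosedCurve γ L) {s : ℝ}
    {v : Minkowski} (hv : HasStrictDerivAt (fun s => (γ s).pos) v s) : lorentz v v = 1 := by
  refine le_antisymm (lorentz_deriv_le_one h hv.hasDerivAt) ?_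
  by_contra! hlt
  -- A smaller velocity would make the curve a contraction near to `s`.
  obtain ⟨c, hc0, hcv, hc1⟩ : ∃ c : ℝ, 0 < c ∧ lorentz v v < c ^ 2 ∧ c < 1 := by
    refine ⟨√(max (1 / 4) ((lorentz v v + 1) / 2)), ?_, ?_, ?_⟩
    · exact Real.sqrt_pos.2 (lt_max_of_lt_left (by norm_num))
    · rw [Real.sq_sqrt (le_max_of_le_left (by norm_num))]
      exact lt_max_of_lt_right (by linarith)
    · rw [Real.sqrt_lt' one_pos, one_pow]
      exact max_lt (by norm_num) (by linarith)
  have h1 := hv.isLittleO.tendsto_inv_smul_nhds_zero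
  have h2 : Continuous fun w : Minkowski => lorentz (w + v) (w + v) :=
    (continuous_id.add continuous_const).lorentz (continuous_id.add continuous_const)
  have h3 := (h2.tendsto 0).comp h1
  simp only [zero_add] at h3
  have h4 := h3.eventually_lt_const hcv
  rw [Metric.eventually_nhds_iff_ball] at h4
  obtain ⟨δ, hδ, hδc⟩ := h4
  have hlip : LipschitzOnWith c.toNNReal γ (Set.Icc s (s + δ / 2)) := by
    refine LipschitzOnWith.of_dist_le_mul fun x hx y hy => ?_
    rw [Real.coe_toNNReal _ hc0.le, Real.dist_eq]
    rcases eq_or_ne x y with rfl | hxy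
    · simp
    have hxy0 : x - y ≠ 0 := sub_ne_zero.2 hxy
    have h5 := hδc (x, y) (by
      rw [Metric.mem_ball, Prod.dist_eq, max_lt_iff]
      simp only [Real.dist_eq]
      rw [abs_of_nonneg (by linarith [hx.1]), abs_of_nonneg (by linarith [hy.1])]
      constructor <;> linarith [hx.2, hy.2])
    simp only [Function.comp_def] at h5
    have h6 : (x - y)⁻¹ • ((γ x).pos - (γ y).pos - (ContinuousLinearMap.toSpanSingleton ℝ v)
        (x - y)) + v = (x - y)⁻¹ • ((γ x).pos - (γ y).pos) := by
      rw [ContinuousLinearMap.toSpanSingleton_apply, smul_sub, inv_smul_smul₀ hxy0, sub_add_cancel]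
    rw [h6, lorentz_smul_smul, lorentz_sub_pos, inv_pow,
      inv_mul_lt_iff₀ (by positivity)] at h5
    have h7 := sq_le_two_mul_cosh_sub_one (dist (γ x) (γ y))
    apply le_of_sq_le_sq _ (by positivity)
    rw [mul_pow, sq_abs]
    linarith
  have h5 := hlip.comp_eVariationOn_le (f := γ) (g := id) (s := Set.Icc s (s + δ / 2))
    (fun x hx => hx)
  have h6 := h.unitSpeed (Set.mem_univ s) (Set.mem_univ (s + δ / 2))
  rw [Set.univ_inter] at h6
  rw [Function.comp_id, h6, eVariationOn_id_Icc, ← ENNReal.ofReal_coe_nnreal,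
    ← ENNReal.ofReal_mul (NNReal.coe_nonneg _), Real.coe_toNNReal _ hc0.le,
    ENNReal.ofReal_le_ofReal_iff (mul_nonneg hc0.le (by linarith))] at h5
  simp only [NNReal.coe_one, one_mul, add_sub_cancel_left] at h5
  nlinarith

/-- For the velocity `v` and the acceleration `w` of a curve of unit speed at `q`: the
Cauchy–Schwarz inequality of the curvature vector and the component of `p` that is tangent to the
hyperboloid and normal to the curve. -/
theorem curvature_inequality (p q : Hyp3) {v w : Minkowski} (hv0 : lorentz q.pos v = 0)
    (hv : lorentz v v = 1) (hw0 : lorentz q.pos w = -1) (hvw : lorentz v w = 0) :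
    0 ≤ lorentz p.pos q.pos ^ 2 - 1 - lorentz p.pos v ^ 2 ∧
    (lorentz p.pos w - lorentz p.pos q.pos) ^ 2 ≤
      (lorentz p.pos q.pos ^ 2 - 1 - lorentz p.pos v ^ 2) *
        lorentz (tangentProj q w) (tangentProj q w) := by
  have e0 : lorentz q.pos (tangentProj q p.pos + (-lorentz p.pos v) • v) = 0 := by
    rw [lorentz_add_right, lorentz_tangentProj, lorentz_smul_right, hv0]; ring
  have e1 : lorentz (tangentProj q p.pos + (-lorentz p.pos v) • v)
      (tangentProj q p.pos + (-lorentz p.pos v) • v) =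
      lorentz p.pos q.pos ^ 2 - 1 - lorentz p.pos v ^ 2 := by
    simp only [tangentProj, lorentz_add_left, lorentz_add_right, lorentz_smul_left,
      lorentz_smul_right, q.lorentz_self, p.lorentz_self, hv, hv0, lorentz_comm v q.pos,
      lorentz_comm q.pos p.pos, lorentz_comm v p.pos]
    ring
  have e2 : lorentz (tangentProj q p.pos + (-lorentz p.pos v) • v) (tangentProj q w) =
      lorentz p.pos w - lorentz p.pos q.pos := by
    simp only [tangentProj, lorentz_add_left, lorentz_add_right, lorentz_smul_left,
      lorentz_smul_right, q.lorentz_self, hv0, hw0, hvw, lorentz_comm v q.pos,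
      lorentz_comm q.pos p.pos]
    ring
  have h1 := lorentz_self_nonneg q _ e0
  have h2 := lorentz_cauchy_schwarz q _ _ e0 (lorentz_tangentProj q w)
  rw [e1] at h1
  rw [e1, e2] at h2
  exact ⟨h1, h2⟩

/-- The pointwise inequality behind the Gauss–Bonnet formula of a cone, for real numbers: `P` and
`S` are the hyperbolic cosine and sine of the distance from the apex, `P₁` and `P₂` are the
derivatives of `P` along the curve, and `k` is the curvature. On the left is `P` times the speed of
the direction, and the middle summand on the right is the derivative of `-ψ`. Here `ψ` is the angle
of the curve with the radial direction, so that `cos ψ = P₁ / S`, except that the factor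
`√(1 - b²)` keeps the argument of `arccos` away from `±1`, where it is not differentiable. -/
theorem radial_angle_inequality {P P₁ P₂ S k b : ℝ} (hS : 0 < S) (hP : 0 < P)
    (hk : 0 ≤ k) (hb : 0 < b) (hb1 : b < 1) (h0 : 0 ≤ S ^ 2 - P₁ ^ 2)
    (h2 : (P₂ - P) ^ 2 ≤ (S ^ 2 - P₁ ^ 2) * k ^ 2) :
    P * (√(S ^ 2 - P₁ ^ 2) / S ^ 2) ≤ k +
      (1 / √(1 - (√(1 - b ^ 2) * (P₁ / S)) ^ 2)) *
        (√(1 - b ^ 2) * ((P₂ * S - P₁ * (P * P₁ / S)) / S ^ 2)) + P / S * b := by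
  set l := √(1 - b ^ 2) with hl
  have hbb : 0 < 1 - b ^ 2 := by nlinarith
  have hl0 : 0 < l := Real.sqrt_pos.2 hbb
  have hl2 : l ^ 2 = 1 - b ^ 2 := Real.sq_sqrt hbb.le
  set R := √(S ^ 2 - P₁ ^ 2) with hR
  have hR0 : 0 ≤ R := Real.sqrt_nonneg _
  have hR2 : R ^ 2 = S ^ 2 - P₁ ^ 2 := Real.sq_sqrt h0
  set σ := R / S with hσ
  have hσ0 : 0 ≤ σ := by positivity
  have hq2 : 1 - (l * (P₁ / S)) ^ 2 = l ^ 2 * σ ^ 2 + b ^ 2 := by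
    rw [hσ, mul_pow, div_pow, div_pow, hR2, hl2]
    field_simp
    ring
  rw [hq2]
  set q := √(l ^ 2 * σ ^ 2 + b ^ 2) with hq
  have hq0 : 0 < q := Real.sqrt_pos.2 (by positivity)
  have hqq : q ^ 2 = l ^ 2 * σ ^ 2 + b ^ 2 := Real.sq_sqrt (by positivity)
  have hσ1 : σ ≤ 1 := by
    rw [hσ, div_le_one hS]
    exact le_of_sq_le_sq (by rw [hR2]; nlinarith [sq_nonneg P₁]) hS.le
  have hσq : σ ≤ q := by
    refine le_of_sq_le_sq ?_ hq0.le
    rw [hqq, hl2]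
    nlinarith [sq_nonneg b, mul_nonneg hσ0 hσ0,
      mul_nonneg (sq_nonneg b) (sub_nonneg.2 (show σ ^ 2 ≤ 1 by nlinarith))]
  have hqb : q ≤ l * σ + b := by
    refine le_of_sq_le_sq ?_ (by positivity)
    rw [hqq]
    nlinarith [mul_nonneg (mul_nonneg hl0.le hσ0) hb.le]
  have hl1 : l ≤ 1 := le_of_sq_le_sq (by rw [hl2]; nlinarith [sq_nonneg b]) zero_le_one
  have hP2 : -(k * R) ≤ P₂ - P := by
    have h3 : (P₂ - P) ^ 2 ≤ (k * R) ^ 2 := by rw [mul_pow, hR2]; linarith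
    exact (abs_le_of_sq_le_sq' h3 (by positivity)).1
  have hw : -(k * σ) + P / S * σ ^ 2 ≤ (P₂ * S - P₁ * (P * P₁ / S)) / S ^ 2 := by
    have e : (P₂ * S - P₁ * (P * P₁ / S)) / S ^ 2 = (P₂ - P) / S + P / S * σ ^ 2 := by
      rw [hσ, div_pow, hR2]
      field_simp
      ring
    rw [e]
    have : -(k * σ) ≤ (P₂ - P) / S := by
      rw [le_div_iff₀ hS, hσ]
      have : -(k * (R / S)) * S = -(k * R) := by field_simp
      rw [this]
      exact hP2
    linarith
  have h3 : 1 / q * (l * (-(k * σ) + P / S * σ ^ 2)) ≤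
      1 / q * (l * ((P₂ * S - P₁ * (P * P₁ / S)) / S ^ 2)) := by gcongr
  have h4 : P * (R / S ^ 2) = P / S * σ := by rw [hσ]; field_simp
  rw [h4]
  refine le_trans ?_ (add_le_add_left (add_le_add_right h3 k) _)
  clear_value q σ R l
  have h5 : 0 ≤ k * (1 - l * σ / q) := by
    refine mul_nonneg hk (sub_nonneg.2 ((div_le_one hq0).2 ?_))
    exact (mul_le_of_le_one_left hσ0 hl1).trans hσq
  have h6 : σ - l * σ ^ 2 / q ≤ b := by
    have h7 : σ - l * σ ^ 2 / q = σ / q * (q - l * σ) := by field_simp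
    rw [h7]
    have h8 : σ / q ≤ 1 := (div_le_one hq0).2 hσq
    have h9 : 0 ≤ σ / q := by positivity
    calc σ / q * (q - l * σ) ≤ σ / q * b := mul_le_mul_of_nonneg_left (by linarith) h9
      _ ≤ 1 * b := mul_le_mul_of_nonneg_right h8 hb.le
      _ = b := one_mul b
  have h7 : 0 < P / S := by positivity
  have h8 : k + 1 / q * (l * (-(k * σ) + P / S * σ ^ 2)) + P / S * b - P / S * σ =
      k * (1 - l * σ / q) + P / S * (b - (σ - l * σ ^ 2 / q)) := by
    field_simp
    ring
  have h9 := mul_nonneg h7.le (sub_nonneg.2 h6)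
  linarith

/-- The derivatives of the position, the velocity and the acceleration of a `C²` curve that is
parametrized by arc length satisfy the Frenet relations. -/
theorem frenet_relations {γ : ℝ → Hyp3} {L : ℝ} (h : IsRectifiableClosedCurve γ L)
    (hC : ContDiff ℝ 2 fun s => (γ s).pos) :
    ∃ v w : ℝ → Minkowski, Continuous w ∧ Function.Periodic v L ∧
      (∀ s, HasDerivAt (fun s => (γ s).pos) (v s) s) ∧ (∀ s, HasDerivAt v (w s) s) ∧
      (∀ s, lorentz (γ s).pos (v s) = 0) ∧ (∀ s, lorentz (v s) (v s) = 1) ∧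
      (∀ s, lorentz (γ s).pos (w s) = -1) ∧ (∀ s, lorentz (v s) (w s) = 0) ∧
      ∀ s, geodesicCurvature γ s =
        √(lorentz (tangentProj (γ s) (w s)) (tangentProj (γ s) (w s))) := by
  set g : ℝ → Minkowski := fun s => (γ s).pos with hg
  have hg1 : ∀ s, HasDerivAt g (deriv g s) s := fun s =>
    (hC.differentiable two_ne_zero s).hasDerivAt
  have hd1 : ContDiff ℝ 1 (deriv g) := by
    have : ContDiff ℝ (1 + 1) g := hC
    exact (contDiff_succ_iff_deriv.1 this).2.2
  have hg2 : ∀ s, HasDerivAt (deriv g) (deriv (deriv g) s) s := fun s =>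
    (hd1.differentiable one_ne_zero s).hasDerivAt
  have hv1 : ∀ s, lorentz (deriv g s) (deriv g s) = 1 := fun s =>
    lorentz_deriv_eq_one h (hC.contDiffAt.hasStrictDerivAt two_ne_zero)
  have hv0 : ∀ s, lorentz (g s) (deriv g s) = 0 := by
    intro s
    have h1 := (hg1 s).lorentz (hg1 s)
    have h2 : (fun s => lorentz (g s) (g s)) = fun _ => -1 :=
      funext fun s => (γ s).lorentz_self
    rw [h2] at h1
    have h3 := h1.unique (hasDerivAt_const s (-1 : ℝ))
    rw [lorentz_comm (deriv g s)] at h3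
    linarith
  refine ⟨deriv g, deriv (deriv g), hd1.continuous_deriv le_rfl, ?_, hg1, hg2, hv0, hv1, ?_, ?_,
    fun s => rfl⟩
  · intro s
    have h1 : (fun x => g (x + L)) = g := funext fun x => by simp only [hg, h.periodic x]
    have h2 := deriv_comp_add_const g L s
    rw [h1] at h2
    exact h2.symm
  · intro s
    have h1 := (hg1 s).lorentz (hg2 s)
    rw [funext hv0] at h1
    have h3 := h1.unique (hasDerivAt_const s (0 : ℝ))
    rw [hv1 s] at h3
    change lorentz (g s) _ = -1
    linarith
  · intro s
    have h1 := (hg2 s).lorentz (hg2 s)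
    rw [funext hv1] at h1
    have h3 := h1.unique (hasDerivAt_const s (1 : ℝ))
    rw [lorentz_comm (deriv (deriv g) s)] at h3
    linarith

theorem HasDerivAt.chart {f : ℝ → Minkowski} {f' : Minkowski} {s : ℝ} (p : Hyp3)
    (hf : HasDerivAt f f' s) : HasDerivAt (fun s => chart p (f s)) (chart p f') s := by
  let A : Minkowski →ₗ[ℝ] EuclideanSpace ℝ (Fin 3) :=
    { toFun := _root_.chart p, map_add' := chart_add p, map_smul' := chart_smul p }
  exact (A.toContinuousLinearMap).hasFDerivAt.comp_hasDerivAt s hf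

/-- The derivative of the direction of a curve, in terms of the hyperbolic cosine `P` of the
distance, the hyperbolic sine `S`, and the derivative of `P`. -/
theorem hasDerivAt_direction {p : Hyp3} {γ : ℝ → Hyp3} (hp : SeesOnce p γ) {s : ℝ} {v : Minkowski}
    (hv : HasDerivAt (fun s => (γ s).pos) v s) (hv0 : lorentz (γ s).pos v = 0)
    (hv1 : lorentz v v = 1) : ∃ u', HasDerivAt (direction p γ) u' s ∧
      ‖u'‖ = √(Real.sinh (dist p (γ s)) ^ 2 - lorentz p.pos v ^ 2) /
        Real.sinh (dist p (γ s)) ^ 2 ∧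
      HasDerivAt (fun s => Real.sinh (dist p (γ s)))
        (Real.cosh (dist p (γ s)) * (-lorentz p.pos v) / Real.sinh (dist p (γ s))) s := by
  set S := Real.sinh (dist p (γ s)) with hS
  set P := Real.cosh (dist p (γ s)) with hP
  have hS0 : 0 < S := Real.sinh_pos_iff.2 (hp.dist_pos s)
  have hPl : lorentz p.pos (γ s).pos = -P := by rw [hP, cosh_dist, neg_neg]
  have hSP : S ^ 2 = P ^ 2 - 1 := Real.sinh_sq _
  have hPd : HasDerivAt (fun s => lorentz p.pos (γ s).pos) (lorentz p.pos v) s := by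
    refine ((hasDerivAt_const s p.pos).lorentz hv).congr_deriv ?_
    simp [lorentz]
  have hSeq : ∀ s, Real.sinh (dist p (γ s)) = √(lorentz p.pos (γ s).pos ^ 2 - 1) := fun s => by
    rw [← norm_chart_sq, Real.sqrt_sq (norm_nonneg _), norm_chart_eq_sinh]
  have hSd : HasDerivAt (fun s => Real.sinh (dist p (γ s))) (P * (-lorentz p.pos v) / S) s := by
    rw [funext hSeq]
    have h0 : lorentz p.pos (γ s).pos ^ 2 - 1 = S ^ 2 := by rw [hPl, hSP]; ring
    refine (((hPd.pow 2).sub_const 1).sqrt (by rw [Pi.pow_apply, h0]; positivity)).congr_deriv ?_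
    rw [Pi.pow_apply, h0, Real.sqrt_sq hS0.le, hPl]
    field_simp
    ring
  have hy := hv.chart p
  have hdir : direction p γ = fun s => (Real.sinh (dist p (γ s)))⁻¹ • chart p (γ s).pos := by
    funext s
    rw [direction, norm_chart_eq_sinh]
  have hu := (hSd.inv hS0.ne').smul hy
  refine ⟨S⁻¹ • chart p v + (-(P * -lorentz p.pos v / S) / S ^ 2) • chart p (γ s).pos,
    by rw [hdir]; exact hu, ?_, hSd⟩
  have hR : 0 ≤ √(S ^ 2 - lorentz p.pos v ^ 2) / S ^ 2 := by positivity
  have hnn : 0 ≤ S ^ 2 - lorentz p.pos v ^ 2 := by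
    have h1 := lorentz_cauchy_schwarz (γ s) _ _ (lorentz_tangentProj (γ s) p.pos) hv0
    simp only [tangentProj, lorentz_add_left, lorentz_add_right, lorentz_smul_left,
      lorentz_smul_right, (γ s).lorentz_self, p.lorentz_self, hv0, hv1,
      lorentz_comm (γ s).pos p.pos, hPl] at h1
    linarith
  rw [← sq_eq_sq₀ (norm_nonneg _) hR, div_pow, Real.sq_sqrt hnn, ← real_inner_self_eq_norm_sq]
  simp only [inner_add_left, inner_add_right, real_inner_smul_left, real_inner_smul_right,
    inner_chart, hv1, hv0, (γ s).lorentz_self, lorentz_comm v (γ s).pos, hPl]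
  have hPS : P ^ 2 = S ^ 2 + 1 := by rw [hSP]; ring
  clear_value S P
  field_simp
  rw [show -1 + P ^ 2 = S ^ 2 by linarith]
  linear_combination (-(S ^ 2 * lorentz p.pos v ^ 2)) * hPS

/-- The total geodesic curvature dominates the area and the cone angle of a geodesic cone over a
curve of class `C²`, up to an error that is proportional to the regularization `b` of the angle of
the curve with the radial direction. -/
theorem diskArea_coneDisk_le_integral_add {γ : ℝ → Hyp3} {L : ℝ} (h : IsRectifiableClosedCurve γ L)
    (hC : ContDiff ℝ 2 fun s => (γ s).pos) {p : Hyp3} (hp : SeesOnce p γ) : ∃ B : ℝ, 0 ≤ B ∧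
      ∀ b : ℝ, 0 < b → b < 1 → visualLength p γ L - visualLength p γ 0 ≤
        (∫ s in (0)..L, geodesicCurvature γ s) + B * b ∧
      diskArea (coneDisk p γ L) ≤ ENNReal.ofReal ((∫ s in (0)..L, geodesicCurvature γ s) + B * b -
        (visualLength p γ L - visualLength p γ 0)) := by
  obtain ⟨v, w, hwc, hvper, hgd, hvd, hv0, hv1, hw0, hvw, hk⟩ := frenet_relations h hC
  obtain ⟨r, R, hr, hrR⟩ := exists_dist_bounds h hp
  have hr0 : 0 < Real.sinh r := Real.sinh_pos_iff.2 hr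
  refine ⟨Real.cosh R / Real.sinh r * L, mul_nonneg (div_nonneg (Real.cosh_pos _).le hr0.le)
    h.length_pos.le, fun b hb hb1 => ?_⟩
  set S : ℝ → ℝ := fun s => Real.sinh (dist p (γ s)) with hS
  set P : ℝ → ℝ := fun s => Real.cosh (dist p (γ s)) with hP
  set k : ℝ → ℝ := geodesicCurvature γ with hkdef
  have hS0 : ∀ s, 0 < S s := fun s => Real.sinh_pos_iff.2 (hp.dist_pos s)
  have hPS : ∀ s, P s / S s ≤ Real.cosh R / Real.sinh r := by
    intro s
    refine div_le_div₀ (Real.cosh_pos _).le ?_ hr0 (Real.sinh_le_sinh.2 (hrR s).1)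
    rw [Real.cosh_le_cosh, abs_of_nonneg dist_nonneg]
    exact (hrR s).2.trans (le_abs_self R)
  have hPl : ∀ s, lorentz p.pos (γ s).pos = -P s := fun s => by
    simp only [hP]
    rw [cosh_dist, neg_neg]
  have hgc : Continuous fun s => (γ s).pos := hC.continuous
  have hkc : Continuous k := by
    have h1 : Continuous fun s => tangentProj (γ s) (w s) := by
      unfold tangentProj
      exact hwc.add ((hgc.lorentz hwc).smul hgc)
    rw [funext hk]
    exact Real.continuous_sqrt.comp (h1.lorentz h1)
  set P₁ : ℝ → ℝ := fun s => -lorentz p.pos (v s) with hP₁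
  set P₂ : ℝ → ℝ := fun s => -lorentz p.pos (w s) with hP₂
  have hP₁d : ∀ s, HasDerivAt P₁ (P₂ s) s := fun s => by
    refine ((hasDerivAt_const s p.pos).lorentz (hvd s)).neg.congr_deriv ?_
    simp [hP₂, lorentz]
  choose u' hu' hu'n hSd using fun s => hasDerivAt_direction hp (hgd s) (hv0 s) (hv1 s)
  have hineq : ∀ s, 0 ≤ S s ^ 2 - P₁ s ^ 2 ∧
      (P₂ s - P s) ^ 2 ≤ (S s ^ 2 - P₁ s ^ 2) * k s ^ 2 := by
    intro s
    have h1 := curvature_inequality p (γ s) (hv0 s) (hv1 s) (hw0 s) (hvw s)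
    have h2 : lorentz p.pos (γ s).pos ^ 2 - 1 = S s ^ 2 := by
      rw [hPl, neg_sq]
      simp only [hS, hP]
      rw [Real.sinh_sq]
    have h3 : k s ^ 2 = lorentz (tangentProj (γ s) (w s)) (tangentProj (γ s) (w s)) := by
      rw [hk, Real.sq_sqrt (lorentz_self_nonneg (γ s) _ (lorentz_tangentProj _ _))]
    rw [h2, ← h3, hPl] at h1
    simp only [hP₁, hP₂, neg_sq]
    refine ⟨h1.1, le_trans (le_of_eq ?_) h1.2⟩
    ring
  set l := √(1 - b ^ 2) with hl
  -- The angle of the curve with the radial direction, regularized where the curve is radial.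
  set ψ : ℝ → ℝ := fun s => Real.arccos (l * (P₁ s / S s)) with hψ
  have hbb : 0 < 1 - b ^ 2 := by nlinarith
  have hψd : ∀ s, HasDerivAt ψ (-(1 / √(1 - (l * (P₁ s / S s)) ^ 2)) *
      (l * ((P₂ s * S s - P₁ s * (P s * P₁ s / S s)) / S s ^ 2))) s := by
    intro s
    have h1 : (l * (P₁ s / S s)) ^ 2 < 1 := by
      have h2 : (P₁ s / S s) ^ 2 ≤ 1 := by
        rw [div_pow, div_le_one (pow_pos (hS0 s) 2)]
        linarith [(hineq s).1]
      rw [mul_pow, hl, Real.sq_sqrt hbb.le]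
      nlinarith [sq_pos_of_pos hb]
    have h2 := (sq_lt_one_iff_abs_lt_one _).1 h1
    rw [abs_lt] at h2
    have h3 : HasDerivAt (fun s => l * (P₁ s / S s))
        (l * ((P₂ s * S s - P₁ s * (P s * P₁ s / S s)) / S s ^ 2)) s :=
      ((hP₁d s).div (hSd s) (hS0 s).ne').const_mul l
    have h4 := Real.hasDerivAt_arccos h2.1.ne' h2.2.ne
    exact HasDerivAt.comp (h₂ := Real.arccos) s h4 h3
  set B := Real.cosh R / Real.sinh r with hB
  -- By the radial angle inequality, the increments of `G` dominate those of the direction, weighted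
  -- by the hyperbolic cosine of the distance.
  set G : ℝ → ℝ := fun s => (∫ x in (0)..s, k x) - ψ s + B * b * s with hG
  set G' : ℝ → ℝ := fun s => k s + (1 / √(1 - (l * (P₁ s / S s)) ^ 2)) *
      (l * ((P₂ s * S s - P₁ s * (P s * P₁ s / S s)) / S s ^ 2)) + B * b with hG'
  have hGd : ∀ s, HasDerivAt G (G' s) s := by
    intro s
    have h1 : HasDerivAt (fun s => ∫ x in (0)..s, k x) (k s) s :=
      intervalIntegral.integral_hasDerivAt_right (hkc.intervalIntegrable _ _)
        (hkc.stronglyMeasurableAtFilter _ _) hkc.continuousAt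
    refine ((h1.sub (hψd s)).add ((hasDerivAt_id s).const_mul (B * b))).congr_deriv ?_
    simp only [hG']
    ring
  have hG'u : ∀ s, P s * ‖u' s‖ ≤ G' s := by
    intro s
    have h1 := radial_angle_inequality (k := k s) (hS0 s) (Real.cosh_pos (dist p (γ s)))
      (by rw [hk]; exact Real.sqrt_nonneg _) hb hb1 (hineq s).1 (hineq s).2
    have h2 : ‖u' s‖ = √(S s ^ 2 - P₁ s ^ 2) / S s ^ 2 := by
      rw [hu'n]
      simp only [hP₁, neg_sq, hS]
    rw [h2]
    refine h1.trans ?_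
    simp only [hG']
    have := mul_le_mul_of_nonneg_right (hPS s) hb.le
    simp only [hP] at this ⊢
    linarith
  have hPc : Continuous P := Real.continuous_cosh.comp (continuous_const.dist h.continuous)
  have hper : ψ L = ψ 0 := by
    have h1 : γ L = γ 0 := by simpa using h.periodic 0
    have h2 : v L = v 0 := by simpa using hvper 0
    simp only [hψ, hP₁, hS, h1, h2]
  have hGL : G L - G 0 = (∫ s in (0)..L, k s) + B * L * b := by
    simp only [hG, hper, intervalIntegral.integral_same]
    ring
  rw [← hGL]
  refine diskArea_le_of_chainSum_le h hp (X := fun s t => G t - G s)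
    (fun T hT => (hT.eq_sub fun _ _ _ => rfl).le) ?_
  intro η hη
  obtain ⟨δ, hδ, hδP⟩ := Metric.uniformContinuousOn_iff.1
    (isCompact_Icc.uniformContinuousOn_of_continuous (hPc.continuousOn (s := Set.Icc 0 L))) η hη
  refine ⟨δ, hδ, fun s t hs hst ht hd => ?_⟩
  -- A nonnegative lower bound of the weight on the arc.
  set c := max (P s - η) 0 with hc
  have hcP : ∀ x ∈ Set.Ico s t, c ≤ P x := by
    intro x hx
    have h1 := hδP x ⟨hs.trans hx.1, hx.2.le.trans ht⟩ s ⟨hs, hst.trans ht⟩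
      (by rw [Real.dist_eq, abs_of_nonneg (by linarith [hx.1])]; linarith [hx.2])
    rw [Real.dist_eq, abs_lt] at h1
    exact max_le (by linarith) (Real.cosh_pos _).le
  have hfd : ∀ x, HasDerivAt (fun x => c • (direction p γ x - direction p γ s)) (c • u' x) x :=
    fun x => ((hu' x).sub_const _).const_smul c
  have hbd := image_norm_le_of_norm_deriv_right_le_deriv_boundary
    (f := fun x => c • (direction p γ x - direction p γ s)) (f' := fun x => c • u' x)
    (a := s) (b := t)
    (B := fun x => G x - G s) (B' := G')
    (fun x _ => (hfd x).continuousAt.continuousWithinAt)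
    (fun x _ => (hfd x).hasDerivWithinAt) (by simp) (fun x => (hGd x).sub_const _)
    (fun x hx => by
      rw [norm_smul, Real.norm_eq_abs, abs_of_nonneg (le_max_right _ _)]
      exact (mul_le_mul_of_nonneg_right (hcP x hx) (norm_nonneg _)).trans (hG'u x))
    (⟨hst, le_rfl⟩ : t ∈ Set.Icc s t)
  rw [norm_smul, Real.norm_eq_abs, abs_of_nonneg (le_max_right _ _), norm_sub_rev] at hbd
  exact (mul_le_mul_of_nonneg_right (le_max_left _ _) (norm_nonneg _)).trans hbd

/-- A rectifiable closed curve in the boundary of a convex subset of hyperbolic 3-space bounds disks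
of area less than `θ - 2 π + ε` for every `ε > 0`, where `θ` is the total geodesic curvature; for a
curve of class `C²`, the integral of the geodesic curvature may be taken for `θ`. -/
theorem lemma3 (K : Set Hyp3) (hK : GeodesicallyConvex K) (γ : ℝ → Hyp3) (L : ℝ)
    (hγ : IsRectifiableClosedCurve γ L) (hγK : ∀ s, γ s ∈ frontier K) :
    (∀ ε : ℝ, 0 < ε → ∃ f : ℂ → Hyp3, IsDiskBoundedBy f γ L ∧
      diskArea f + ENNReal.ofReal (2 * Real.pi) < totalCurvature γ L + ENNReal.ofReal ε) ∧
    (ContDiff ℝ 2 (fun s => (γ s).pos) →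
      ∀ ε : ℝ, 0 < ε → ∃ f : ℂ → Hyp3, IsDiskBoundedBy f γ L ∧
        diskArea f < ENNReal.ofReal ((∫ s in (0)..L, geodesicCurvature γ s) - 2 * Real.pi + ε)) := by
  constructor
  · intro ε hε
    obtain ⟨p, hp, hV⟩ := exists_apex hK hγ hγK (half_pos hε)
    refine ⟨coneDisk p γ L,
      isDiskBoundedBy_coneDisk hγ.length_pos hγ.periodic hγ.continuous hp, ?_⟩
    by_cases hfin : totalCurvature γ L = ⊤
    · rw [hfin, top_add]
      exact ENNReal.add_lt_top.2 ⟨diskArea_coneDisk_lt_top hγ hp, ENNReal.ofReal_lt_top⟩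
    · have h1 := diskArea_coneDisk_add_le_totalCurvature hγ hp hfin
      have hV0 : 0 ≤ visualLength p γ L - visualLength p γ 0 := (norm_nonneg _).trans
        (norm_direction_sub_le hγ hp 0 L hγ.length_pos.le)
      calc diskArea (coneDisk p γ L) + ENNReal.ofReal (2 * Real.pi)
          ≤ diskArea (coneDisk p γ L) +
            (ENNReal.ofReal (visualLength p γ L - visualLength p γ 0) +
              ENNReal.ofReal (ε / 2)) := by
            rw [← ENNReal.ofReal_add hV0 (half_pos hε).le]
            gcongr
            linarith
        _ ≤ totalCurvature γ L + ENNReal.ofReal (ε / 2) := by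
            rw [← add_assoc]
            gcongr
        _ < totalCurvature γ L + ENNReal.ofReal ε :=
            ENNReal.add_lt_add_left hfin
              ((ENNReal.ofReal_lt_ofReal_iff hε).2 (half_lt_self hε))
  · intro hC ε hε
    obtain ⟨p, hp, hV⟩ := exists_apex hK hγ hγK (show 0 < ε / 3 by positivity)
    refine ⟨coneDisk p γ L,
      isDiskBoundedBy_coneDisk hγ.length_pos hγ.periodic hγ.continuous hp, ?_⟩
    obtain ⟨B, hB, hb⟩ := diskArea_coneDisk_le_integral_add hγ hC hp
    have hb0 : 0 < min (1 / 2) (ε / 3 / (B + 1)) := by positivity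
    obtain ⟨h1, h2⟩ := hb _ hb0 ((min_le_left _ _).trans_lt (by norm_num))
    have h3 : B * min (1 / 2) (ε / 3 / (B + 1)) ≤ ε / 3 := by
      calc B * min (1 / 2) (ε / 3 / (B + 1)) ≤ (B + 1) * (ε / 3 / (B + 1)) :=
            mul_le_mul (by linarith) (min_le_right _ _) hb0.le (by linarith)
        _ = ε / 3 := by field_simp
    refine h2.trans_lt ((ENNReal.ofReal_lt_ofReal_iff ?_).2 ?_) <;> linarith
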